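/- **Setting.** Let $M>0$, $|a|\le M$, $\Delta=r^2+a^2-2Mr$, $q^2=r^2+a^2\cos^2\theta$, $\Sigma^2=(r^2+a^2)q^2+2Mra^2\sin^2\theta$, $r_{\mathcal H}=M+\sqrt{M^2-a^2}$. Let $\chi:\mathbb R\to[0,1]$ be smooth and let $\mathbf g$ be the Kerr metric in the coordinates $(\theta,r,t_+,\phi_+)$ obtained from Boyer–Lindquist coordinates $(t,r,\theta,\phi)$ by $dt_+=dt+\chi(r)\frac{2Mr}{\Delta}dr$, $d\phi_+=d\phi+\chi(r)\frac{a}{\Delta}dr$ (so $\chi\equiv0$ gives Boyer–Lindquist coordinates, while the coordinates are regular across the horizon if $\chi=1$ near it). Let $\mathcal R_\chi$ be the set of points off the axis ($\sin\theta\ne0$) with $r>0$ such that either $r>r_{\mathcal H}$ or $\chi=1$ in a neighbourhood of $r$. Put $\mathbf T=\partial_{t_+}$, $\mathbf Z=\partial_{\phi_+}$; a timelike vector $X$ is future-oriented if $dt_+(X)>0$. Let $\mathbf D$ be the Levi-Civita connection, $\square=\mathbf D^\mu\mathbf D_\mu$, and let $(A,B)$ be the Ernst potential of $\mathbf Z$,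 $$A=\frac{\Sigma^2\sin^2\theta}{q^2},\qquad B=-\Big[2aM(3\cos\theta-\cos^3\theta)+\frac{2a^3M\sin^4\theta\cos\theta}{q^2}\Big].$$ Let $U\subseteq\mathcal R_\chi$ be open and let $\phi,\psi\in C^2(U)$ satisfy in $U$ the linearized system with source terms $\mathcal N_\phi,\mathcal N_\psi$, $$\square\phi+2\frac{\mathbf D^\mu B}{A}\mathbf D_\mu\psi-2\frac{\mathbf D^\mu B\mathbf D_\mu B}{A^2}\phi+2\frac{\mathbf D^\mu B\mathbf D_\mu A}{A^2}\psi=\mathcal N_\phi,$$ $$\square\psi-2\frac{\mathbf D^\mu B}{A}\mathbf D_\mu\phi-\frac{\mathbf D^\mu A\mathbf D_\mu A+\mathbf D^\mu B\mathbf D_\mu B}{A^2}\psi=\mathcal N_\psi.$$ Define $$E_\mu=\mathbf D_\mu\phi+\psi A^{-1}\mathbf D_\mu B,\quad F_\mu=\mathbf D_\mu\psi-\phi A^{-1}\mathbf D_\mu B,\quad M_\mu=A^{-1}(\phi\mathbf D_\mu B-\psi\mathbf D_\mu A),$$ $$\mathcal L=-\tfrac12(E_\alpha E^\alpha+F_\alpha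 F^\alpha+M_\alpha M^\alpha),\qquad Q_{\mu\nu}=E_\mu E_\nu+F_\mu F_\nu+M_\mu M_\nu+\mathbf g_{\mu\nu}\mathcal L,$$ $$J_\nu=\frac{2\mathbf D_\nu B\,M^\mu E_\mu-2\mathbf D_\nu A\,M^\mu F_\mu}{A}+\mathcal N_\phi E_\nu+\mathcal N_\psi F_\nu .$$ **Theorem.** The following hold at every point of $U$. (a) If $X,Y$ are future-oriented timelike vectors, then $Q(X,Y)\ge0$, and $Q(X,Y)>0$ unless $E=F=M=0$ at that point. (b) $\mathbf D^\mu Q_{\mu\nu}=J_\nu$. (b') For every $C^1$ vector field $X$, $C^2$ function $w$ and $C^1$ one-forms $m,m'$ on $U$, the current $$P_\mu=P_\mu[X,w,m,m']=Q_{\mu\nu}X^\nu+\tfrac12w(\phi E_\mu+\psi F_\mu)-\tfrac14\mathbf D_\mu w(\phi^2+\psi^2)+\tfrac14(m_\mu\phi^2+m'_\mu\psi^2)$$ satisfies, with ${}^{(X)}\pi^{\mu\nu}=\mathbf D^\mu X^\nu+\mathbf D^\nu X^\mu$, $$2\mathbf D^\mu P_\mu=2X^\nu J_\nu+Q_{\mu\nu}{}^{(X)}\pi^{\mu\nu}-2w\mathcal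 L+\phi m^\mu\mathbf D_\mu\phi+\psi m'^\mu\mathbf D_\mu\psi+\tfrac12\phi^2(\mathbf D^\mu m_\mu-\square w)+\tfrac12\psi^2(\mathbf D^\mu m'_\mu-\square w)+w(\phi\mathcal N_\phi+\psi\mathcal N_\psi).$$ (c) If $\mathcal N_\phi=\mathcal N_\psi=0$ in $U$, then $\mathbf g(\mathbf T,J)=\mathbf T^\nu J_\nu=0$, and the energy current $Q_{\mu\nu}\mathbf T^\nu$ is conserved: $\mathbf D^\mu(Q_{\mu\nu}\mathbf T^\nu)=0$. (d) If $\mathbf Z\phi=\mathbf Z\psi=0$ in $U$, then $Q(\mathbf Z,X)=0$ for every vector $X$ with $\mathbf g(\mathbf Z,X)=0$. (e) (Coercivity) If $\mathbf Z\phi=\mathbf Z\psi=0$ in $U$, then the normal $n=-\operatorname{grad}t_+$ of the hypersurfaces $t_+=\mathrm{const}$ is future-oriented timelike and orthogonal to $\mathbf Z$, and, with indices $1,2,3$ for $\theta,r,t_+$, $$Q(\mathbf T,n)=\frac12\sum_{Y\in\{E,F,M\}}\Big[\frac{(Y_1)^2}{q^2}+\frac{\Delta}{q^2}(Y_2)^2+\Big(\big(1+\tfrac{2Mr}{q^2}\big)\chi^2+\frac{\Sigma^2}{q^2\Delta}(1-\chi^2)\Big)(Y_3)^2\Big],$$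 where the term with $1-\chi^2$ is $0$ wherever $\Delta=0$. Moreover, for every $x\in\mathcal R_\chi$ with $r>r_{\mathcal H}$ and every future-oriented timelike vector $X$ at $x$ with $\mathbf g(X,\mathbf Z)=0$ there is $c>0$, depending only on $M,a,\chi,x,X$, such that $$Q(\mathbf T,X)\ge c\sum_\mu\big(E_\mu^2+F_\mu^2+M_\mu^2\big)\quad\text{at }x$$ for all $\phi,\psi$ that are differentiable at $x$ with $\mathbf Z\phi=\mathbf Z\psi=0$ at $x$. -/

import Mathlib

open scoped ContDiff Topology

noncomputable section

namespace KerrErnst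

/-! ### Tensor calculus in a coordinate chart of a four-dimensional spacetime

Points, tangent vectors and covectors are given by their four coordinates or components; tensor
fields are functions of the point. A metric is a field of symmetric matrices. -/

/-- Coordinates of a point. In the Kerr chart: `x 0 = θ`, `x 1 = r`, `x 2 = t₊`, `x 3 = φ₊`. -/
abbrev Pt := Fin 4 → ℝ

/-- Components of a tangent vector (upper index). -/
abbrev Vec := Fin 4 → ℝ

/-- Components of a covector (lower index). -/
abbrev Covec := Fin 4 → ℝ

/-- Components of a two-tensor at a point. -/
abbrev Tensor2 := Fin 4 → Fin 4 → ℝ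

/-- A metric field, through its components `g x μ ν`. -/
abbrev MetricField := Pt → Matrix (Fin 4) (Fin 4) ℝ

/-- The coordinate derivative `∂_μ f`. -/
def pd (μ : Fin 4) (f : Pt → ℝ) (x : Pt) : ℝ := fderiv ℝ f x (Pi.single μ 1)

/-- The differential of a function, as a one-form. -/
def dform (f : Pt → ℝ) (x : Pt) : Covec := fun μ => pd μ f x

/-- The value of a two-tensor (lower indices) on two vectors. -/
def evalTensor (S : Tensor2) (X Y : Vec) : ℝ := ∑ μ, ∑ ν, S μ ν * X μ * Y ν

/-- The value of a covector on a vector. -/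
def pairing (m : Covec) (X : Vec) : ℝ := ∑ μ, m μ * X μ

/-- The scalar product `g(X, Y)` of vectors. -/
def inner4 (g : MetricField) (x : Pt) (X Y : Vec) : ℝ := evalTensor (g x) X Y

/-- The components `g^{μν}` of the inverse metric. -/
def gInv (g : MetricField) (x : Pt) : Matrix (Fin 4) (Fin 4) ℝ := (g x)⁻¹

/-- The scalar product `m^μ η_μ = g^{μν} m_μ η_ν` of covectors. -/
def dot (g : MetricField) (x : Pt) (m η : Covec) : ℝ := ∑ μ, ∑ ν, gInv g x μ ν * m μ * η ν

/-- The Christoffel symbols `Γ^κ_{μν}` of the Levi-Civita connection `D`. -/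
def christoffel (g : MetricField) (x : Pt) (κ μ ν : Fin 4) : ℝ :=
  (1 / 2) * ∑ ρ, gInv g x κ ρ *
    (pd μ (fun y => g y ν ρ) x + pd ν (fun y => g y μ ρ) x - pd ρ (fun y => g y μ ν) x)

/-- The covariant derivative `D_μ X^ν` of a vector field. -/
def covVec (g : MetricField) (X : Pt → Vec) (x : Pt) (μ ν : Fin 4) : ℝ :=
  pd μ (fun y => X y ν) x + ∑ κ, christoffel g x ν μ κ * X x κ

/-- The covariant derivative `D_μ m_ν` of a one-form. -/
def covForm (g : MetricField) (m : Pt → Covec) (x : Pt) (μ ν : Fin 4) : ℝ :=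
  pd μ (fun y => m y ν) x - ∑ κ, christoffel g x κ μ ν * m x κ

/-- The covariant derivative `D_κ S_{μν}` of a two-tensor. -/
def covTensor (g : MetricField) (S : Pt → Tensor2) (x : Pt) (κ μ ν : Fin 4) : ℝ :=
  pd κ (fun y => S y μ ν) x
    - ∑ ρ, (christoffel g x ρ κ μ * S x ρ ν + christoffel g x ρ κ ν * S x μ ρ)

/-- The divergence `D^μ m_μ` of a one-form. -/
def divForm (g : MetricField) (m : Pt → Covec) (x : Pt) : ℝ :=
  ∑ μ, ∑ ν, gInv g x μ ν * covForm g m x μ ν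

/-- The divergence `D^μ S_{μν}` of a two-tensor. -/
def divTensor (g : MetricField) (S : Pt → Tensor2) (x : Pt) (ν : Fin 4) : ℝ :=
  ∑ κ, ∑ μ, gInv g x κ μ * covTensor g S x κ μ ν

/-- The wave operator `□ f = D^μ D_μ f`. -/
def box (g : MetricField) (f : Pt → ℝ) (x : Pt) : ℝ := divForm g (dform f) x

/-- The deformation tensor `π^{μν} = D^μ X^ν + D^ν X^μ` of a vector field `X`. -/
def deformation (g : MetricField) (X : Pt → Vec) (x : Pt) (μ ν : Fin 4) : ℝ :=
  ∑ κ, (gInv g x μ κ * covVec g X x κ ν + gInv g x ν κ * covVec g X x κ μ)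

/-! ### The Kerr metric and its Ernst potential -/

/-- `Δ = r² + a² - 2 M r`. -/
def Del (M a r : ℝ) : ℝ := r ^ 2 + a ^ 2 - 2 * M * r

/-- `q² = r² + a² cos² θ`. -/
def qsq (a θ r : ℝ) : ℝ := r ^ 2 + a ^ 2 * Real.cos θ ^ 2

/-- `Σ² = (r² + a²) q² + 2 M r a² sin² θ`. -/
def Sigsq (M a θ r : ℝ) : ℝ :=
  (r ^ 2 + a ^ 2) * qsq a θ r + 2 * M * r * a ^ 2 * Real.sin θ ^ 2

/-- The radius `r_H = M + √(M² - a²)` of the event horizon. -/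
def rHor (M a : ℝ) : ℝ := M + Real.sqrt (M ^ 2 - a ^ 2)

/-- The Kerr metric in the coordinates `(θ, r, t₊, φ₊)`, where
`dt₊ = dt + χ(r) (2 M r / Δ) dr`, `dφ₊ = dφ + χ(r) (a / Δ) dr` and `(t, r, θ, φ)` are
Boyer-Lindquist coordinates. For `χ = 0` this is the Boyer-Lindquist form of the metric; where
`χ = 1` it is regular across the horizon (the first summand of `g22` is then `0`). -/
def kerrMetric (M a : ℝ) (χ : ℝ → ℝ) : MetricField := fun x =>
  let θ := x 0
  let r := x 1
  let q2 := qsq a θ r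
  let s2 := Real.sin θ ^ 2
  let g22 := q2 / Del M a r * (1 - χ r ^ 2) + (2 * M * r + q2) / q2 * χ r ^ 2
  let g23 := χ r * (2 * M * r / q2)
  let g24 := -(χ r * (a * s2 * (q2 + 2 * M * r) / q2))
  let g33 := (2 * M * r - q2) / q2
  let g34 := -(2 * a * M * r * s2 / q2)
  let g44 := Sigsq M a θ r * s2 / q2
  !![q2, 0, 0, 0;
     0, g22, g23, g24;
     0, g23, g33, g34;
     0, g24, g34, g44]

/-- The part of the chart, off the axis `sin θ = 0`, in which the coordinates are regular: the
domain of outer communications `r > r_H`, and those `r > 0` near which `χ = 1`. -/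
def kerrRegion (M a : ℝ) (χ : ℝ → ℝ) : Set Pt :=
  {x | 0 < x 1 ∧ Real.sin (x 0) ≠ 0 ∧ (rHor M a < x 1 ∨ ∀ᶠ s in 𝓝 (x 1), χ s = 1)}

/-- The Killing field `T = ∂_t`. -/
def vecT : Vec := Pi.single 2 1

/-- The axial Killing field `Z = ∂_φ`. -/
def vecZ : Vec := Pi.single 3 1

/-- Future-oriented timelike vectors of the Kerr metric, the time orientation being the one for
which the time function `t₊` increases to the future. -/
def IsFutureTimelike (M a : ℝ) (χ : ℝ → ℝ) (x : Pt) (X : Vec) : Prop :=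
  inner4 (kerrMetric M a χ) x X X < 0 ∧ 0 < X 2

/-- The future normal `n = -grad t₊` to the level sets of `t₊`. -/
def normalField (M a : ℝ) (χ : ℝ → ℝ) (x : Pt) : Vec := fun μ => -gInv (kerrMetric M a χ) x 2 μ

/-- The real part `A = g(Z, Z)` of the Ernst potential of `Z`. -/
def ernstA (M a : ℝ) (x : Pt) : ℝ :=
  Sigsq M a (x 0) (x 1) * Real.sin (x 0) ^ 2 / qsq a (x 0) (x 1)

/-- The imaginary part `B` of the Ernst potential of `Z`. -/
def ernstB (M a : ℝ) (x : Pt) : ℝ :=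
  -(2 * a * M * (3 * Real.cos (x 0) - Real.cos (x 0) ^ 3)
    + 2 * a ^ 3 * M * Real.sin (x 0) ^ 4 * Real.cos (x 0) / qsq a (x 0) (x 1))

/-! ### The linearized system, its energy-momentum tensor, source and currents -/

/-- `(φ, ψ)` solves, on `U`, the wave map system linearized at the Ernst potential `(A, B)`, with
source terms `(Nφ, Nψ)`. -/
def SolvesLinearized (M a : ℝ) (χ : ℝ → ℝ) (U : Set Pt) (φ ψ Nφ Nψ : Pt → ℝ) : Prop :=
  let g : MetricField := kerrMetric M a χ
  let A : Pt → ℝ := ernstA M a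
  let dA : Pt → Covec := dform (ernstA M a)
  let dB : Pt → Covec := dform (ernstB M a)
  ∀ x ∈ U,
    box g φ x + 2 * (dot g x (dB x) (dform ψ x) / A x)
        - 2 * (dot g x (dB x) (dB x) / A x ^ 2) * φ x
        + 2 * (dot g x (dB x) (dA x) / A x ^ 2) * ψ x = Nφ x ∧
    box g ψ x - 2 * (dot g x (dB x) (dform φ x) / A x)
        - (dot g x (dA x) (dA x) + dot g x (dB x) (dB x)) / A x ^ 2 * ψ x = Nψ x

/-- `E_μ = D_μ φ + ψ A⁻¹ D_μ B`. -/
def formE (M a : ℝ) (φ ψ : Pt → ℝ) (x : Pt) : Covec := fun μ =>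
  pd μ φ x + ψ x * (ernstA M a x)⁻¹ * pd μ (ernstB M a) x

/-- `F_μ = D_μ ψ - φ A⁻¹ D_μ B`. -/
def formF (M a : ℝ) (φ ψ : Pt → ℝ) (x : Pt) : Covec := fun μ =>
  pd μ ψ x - φ x * (ernstA M a x)⁻¹ * pd μ (ernstB M a) x

/-- `M_μ = A⁻¹ (φ D_μ B - ψ D_μ A)`. -/
def formM (M a : ℝ) (φ ψ : Pt → ℝ) (x : Pt) : Covec := fun μ =>
  (φ x * pd μ (ernstB M a) x - ψ x * pd μ (ernstA M a) x) / ernstA M a x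

/-- `𝓛 = -½ (E_α E^α + F_α F^α + M_α M^α)`. -/
def lagr (M a : ℝ) (χ : ℝ → ℝ) (φ ψ : Pt → ℝ) (x : Pt) : ℝ :=
  -(1 / 2) * (dot (kerrMetric M a χ) x (formE M a φ ψ x) (formE M a φ ψ x)
    + dot (kerrMetric M a χ) x (formF M a φ ψ x) (formF M a φ ψ x)
    + dot (kerrMetric M a χ) x (formM M a φ ψ x) (formM M a φ ψ x))

/-- The energy-momentum tensor `Q_{μν} = E_μ E_ν + F_μ F_ν + M_μ M_ν + g_{μν} 𝓛`. -/
def emTensor (M a : ℝ) (χ : ℝ → ℝ) (φ ψ : Pt → ℝ) (x : Pt) : Tensor2 := fun μ ν =>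
  formE M a φ ψ x μ * formE M a φ ψ x ν + formF M a φ ψ x μ * formF M a φ ψ x ν
    + formM M a φ ψ x μ * formM M a φ ψ x ν + kerrMetric M a χ x μ ν * lagr M a χ φ ψ x

/-- The source
`J_ν = A⁻¹ (2 D_ν B M^μ E_μ - 2 D_ν A M^μ F_μ) + Nφ E_ν + Nψ F_ν`. -/
def source (M a : ℝ) (χ : ℝ → ℝ) (φ ψ Nφ Nψ : Pt → ℝ) (x : Pt) : Covec := fun ν =>
  (2 * pd ν (ernstB M a) x * dot (kerrMetric M a χ) x (formM M a φ ψ x) (formE M a φ ψ x)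
    - 2 * pd ν (ernstA M a) x * dot (kerrMetric M a χ) x (formM M a φ ψ x) (formF M a φ ψ x)) / ernstA M a x
  + Nφ x * formE M a φ ψ x ν + Nψ x * formF M a φ ψ x ν

/-- The modified current
`P_μ = Q_{μν} X^ν + ½ w (φ E_μ + ψ F_μ) - ¼ D_μ w (φ² + ψ²) + ¼ (m_μ φ² + m'_μ ψ²)`. -/
def current (M a : ℝ) (χ : ℝ → ℝ) (φ ψ : Pt → ℝ)
    (X : Pt → Vec) (w : Pt → ℝ) (m m' : Pt → Covec) (x : Pt) : Covec := fun μ =>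
  ∑ ν, emTensor M a χ φ ψ x μ ν * X x ν
    + (1 / 2) * w x * (φ x * formE M a φ ψ x μ + ψ x * formF M a φ ψ x μ)
    - (1 / 4) * pd μ w x * (φ x ^ 2 + ψ x ^ 2)
    + (1 / 4) * (m x μ * φ x ^ 2 + m' x μ * ψ x ^ 2)

/-- The energy current `Q_{μν} T^ν`. -/
def energyCurrent (M a : ℝ) (χ : ℝ → ℝ) (φ ψ : Pt → ℝ) (x : Pt) : Covec := fun μ =>
  ∑ ν, emTensor M a χ φ ψ x μ ν * vecT ν

end KerrErnst

end

open KerrErnst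

noncomputable section

namespace KerrErnst

/-! ### Coordinate derivatives -/

/-! The tensor $Q$ is the sum of the stress tensors $Y_\mu Y_\nu-\frac12\mathbf g_{\mu\nu}Y_\alpha
Y^\alpha$ of the three one-forms $Y=E,F,M$ (`emTensor_eq`), so most assertions reduce to one
covector field at a time.

Positivity: in a Lorentzian frame the claim becomes the dominant energy condition in Minkowski
space. There, after scaling both vectors to time component 1, a positive multiple of the value is a
completed square plus a Gram determinant plus a term controlled by Cauchy-Schwarz
(`minkowski_energy_pos`). The Kerr metric has such a frame wherever its coordinates are regular,
because the $(r,\phi_+)$ block is positive definite and the full determinant is negative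
(`hasFrame_kerr`).

Divergence: for any metric the stress tensor of $Y$ has divergence $(\mathrm{div}\,Y)Y_\nu$ plus the
curl of $Y$ contracted with $Y$ (`RegularAt.divTensor_formStress`). For $E,F,M$ the curls and
divergences are expressed through $d\phi,d\psi,dA,dB$ and the wave operators of $\phi,\psi,A,B$. The
linearized system gives $\square\phi,\square\psi$; the Ernst equations $A\square A=|dA|^2-|dB|^2$
and $A\square B=2\,dA\cdot dB$ give the other two (`ernst_equations`). What remains is a polynomial
identity in scalar products and $A^{-1}$. The Ernst equations themselves become rational identities
in $\cos\theta$ and $r$, since the contracted Christoffel symbols follow from the inverse metric and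
the determinant.

Currents: the product rule reduces $P$ to $\mathbf D^\mu Q_{\mu\nu}$ and the wave equations. For
$\mathbf T$ both the deformation tensor and, without sources, $J(\mathbf T)$ vanish, because neither
the metric nor $(A,B)$ depends on $t_+$.

Coercivity: axial symmetry gives $Y_{\phi_+}=0$, hence $Q(\mathbf Z,X)=0$ for $X\perp\mathbf Z$. So
$Q(\mathbf T,X)=Q(\mathbf T+\Omega\mathbf Z,X)$ for every $\Omega$. Outside the horizon a suitable
$\mathbf T+\Omega\mathbf Z$ is timelike even where $\mathbf T$ is not, and the dominant energy
condition with compactness of the unit sphere yields the constant (`energy_coercive`). -/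

lemma pd_congr {f h : Pt → ℝ} {x : Pt} (μ : Fin 4) (e : f =ᶠ[𝓝 x] h) : pd μ f x = pd μ h x := by
  simp only [pd, e.fderiv_eq]

lemma pd_const (μ : Fin 4) (c : ℝ) (x : Pt) : pd μ (fun _ => c) x = 0 := by
  simp [pd]

lemma pd_add {f h : Pt → ℝ} {x : Pt} (μ : Fin 4) (hf : DifferentiableAt ℝ f x)
    (hh : DifferentiableAt ℝ h x) : pd μ (fun y => f y + h y) x = pd μ f x + pd μ h x := by
  simp only [pd, fderiv_fun_add hf hh]; rfl

lemma pd_sub {f h : Pt → ℝ} {x : Pt} (μ : Fin 4) (hf : DifferentiableAt ℝ f x)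
    (hh : DifferentiableAt ℝ h x) : pd μ (fun y => f y - h y) x = pd μ f x - pd μ h x := by
  simp only [pd, fderiv_fun_sub hf hh]; rfl

lemma pd_mul {f h : Pt → ℝ} {x : Pt} (μ : Fin 4) (hf : DifferentiableAt ℝ f x)
    (hh : DifferentiableAt ℝ h x) :
    pd μ (fun y => f y * h y) x = pd μ f x * h x + f x * pd μ h x := by
  simp only [pd, fderiv_fun_mul hf hh]
  simp; ring

lemma pd_inv {f : Pt → ℝ} {x : Pt} (μ : Fin 4) (hf : DifferentiableAt ℝ f x) (h0 : f x ≠ 0) :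
    pd μ (fun y => (f y)⁻¹) x = -(f x)⁻¹ ^ 2 * pd μ f x := by
  have h := ((hasDerivAt_inv h0).comp_hasFDerivAt x hf.hasFDerivAt).fderiv
  simp only [pd]
  rw [show (fun y => (f y)⁻¹) = Inv.inv ∘ f from rfl, h]
  simp

lemma pd_sum {ι : Type*} {s : Finset ι} {f : ι → Pt → ℝ} {x : Pt} (μ : Fin 4)
    (hf : ∀ i ∈ s, DifferentiableAt ℝ (f i) x) :
    pd μ (fun y => ∑ i ∈ s, f i y) x = ∑ i ∈ s, pd μ (f i) x := by
  simp only [pd, fderiv_fun_sum hf]; simp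

lemma differentiableAt_pd {f : Pt → ℝ} {x : Pt} (μ : Fin 4) (hf : ContDiffAt ℝ 2 f x) :
    DifferentiableAt ℝ (fun y => pd μ f y) x := by
  have h : ContDiffAt ℝ 1 (fderiv ℝ f) x := hf.fderiv_right (by norm_num)
  exact (h.differentiableAt (by norm_num)).clm_apply (differentiableAt_const _)

lemma pd_comm {f : Pt → ℝ} {x : Pt} (hf : ContDiffAt ℝ 2 f x) (μ ν : Fin 4) :
    pd μ (fun y => pd ν f y) x = pd ν (fun y => pd μ f y) x := by
  have h : ContDiffAt ℝ 1 (fderiv ℝ f) x := hf.fderiv_right (by norm_num)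
  have hd := h.differentiableAt (by norm_num)
  have key : ∀ α β : Fin 4, pd α (fun y => pd β f y) x
      = fderiv ℝ (fderiv ℝ f) x (Pi.single α 1) (Pi.single β 1) := by
    intro α β
    simp only [pd]
    rw [fderiv_clm_apply hd (differentiableAt_const _)]
    simp
  rw [key, key]
  exact (hf.isSymmSndFDerivAt (by simp)).eq _ _

/-- A coordinate derivative is the derivative along the coordinate line. -/
lemma hasDerivAt_pd {f : Pt → ℝ} {x : Pt} (μ : Fin 4) (hf : DifferentiableAt ℝ f x) :
    HasDerivAt (fun t => f (Function.update x μ t)) (pd μ f x) (x μ) := by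
  have h1 : HasDerivAt (fun t => Function.update x μ t) (Pi.single μ (1 : ℝ)) (x μ) :=
    hasDerivAt_update x μ (x μ)
  have hf' : HasFDerivAt f (fderiv ℝ f x) (Function.update x μ (x μ)) := by
    simpa using hf.hasFDerivAt
  exact hf'.comp_hasDerivAt _ h1

/-! ### The Levi-Civita connection of a regular metric field -/

/-- The metric field `g` is symmetric, and near `x` it is invertible; its components and those of
its inverse are differentiable at `x`. -/
structure RegularAt (g : MetricField) (x : Pt) : Prop where
  symm : ∀ y μ ν, g y μ ν = g y ν μ
  diff : ∀ μ ν, DifferentiableAt ℝ (fun y => g y μ ν) x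
  diffInv : ∀ μ ν, DifferentiableAt ℝ (fun y => gInv g y μ ν) x
  mul_inv : ∀ᶠ y in 𝓝 x, g y * gInv g y = 1

/-- The matrix of `∂_κ g`. -/
def dMetric (g : MetricField) (x : Pt) (κ : Fin 4) : Matrix (Fin 4) (Fin 4) ℝ :=
  Matrix.of fun μ ν => pd κ (fun y => g y μ ν) x

/-- The matrix of `∂_κ g⁻¹`. -/
def dInv (g : MetricField) (x : Pt) (κ : Fin 4) : Matrix (Fin 4) (Fin 4) ℝ :=
  Matrix.of fun μ ν => pd κ (fun y => gInv g y μ ν) x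

/-- The matrix of the Christoffel symbols `Γ^ρ_{κμ}` for fixed `κ`. -/
def christoffelMat (g : MetricField) (x : Pt) (κ : Fin 4) : Matrix (Fin 4) (Fin 4) ℝ :=
  Matrix.of fun ρ μ => christoffel g x ρ κ μ

/-- The matrix of the Christoffel symbols `Γ_{σκμ}` of the first kind for fixed `κ`. -/
def christoffelLow (g : MetricField) (x : Pt) (κ : Fin 4) : Matrix (Fin 4) (Fin 4) ℝ :=
  Matrix.of fun σ μ => (1 / 2) * (pd κ (fun y => g y μ σ) x + pd μ (fun y => g y κ σ) x
    - pd σ (fun y => g y κ μ) x)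

namespace RegularAt

variable {g : MetricField} {x : Pt}

lemma mul_inv_self (hg : RegularAt g x) : g x * gInv g x = 1 := hg.mul_inv.self_of_nhds

lemma inv_mul_self (hg : RegularAt g x) : gInv g x * g x = 1 :=
  mul_eq_one_comm.mp hg.mul_inv_self

lemma metric_transpose (hg : RegularAt g x) (y : Pt) : (g y).transpose = g y := by
  ext μ ν; exact hg.symm y ν μ

lemma inv_transpose (hg : RegularAt g x) (y : Pt) : (gInv g y).transpose = gInv g y := by
  rw [gInv, Matrix.transpose_nonsing_inv, hg.metric_transpose]

lemma inv_symm (hg : RegularAt g x) (y : Pt) (μ ν : Fin 4) : gInv g y μ ν = gInv g y ν μ := by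
  conv_lhs => rw [← hg.inv_transpose y]
  rfl

lemma pd_symm (hg : RegularAt g x) (κ μ ν : Fin 4) :
    pd κ (fun y => g y μ ν) x = pd κ (fun y => g y ν μ) x := by
  congr 1; funext y; exact hg.symm y μ ν

/-- The last two terms of the symbols of the first kind are antisymmetric in $(\sigma,\mu)$, so
symmetrizing leaves only $\partial_\kappa g$. This is metric compatibility in matrix form. -/
lemma dMetric_eq (hg : RegularAt g x) (κ : Fin 4) :
    dMetric g x κ = christoffelLow g x κ + (christoffelLow g x κ).transpose := by
  ext μ ν
  simp only [dMetric, christoffelLow, Matrix.of_apply, Matrix.add_apply, Matrix.transpose_apply]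
  rw [hg.pd_symm κ ν μ]; ring

lemma christoffelMat_eq (g : MetricField) (x : Pt) (κ : Fin 4) :
    christoffelMat g x κ = gInv g x * christoffelLow g x κ := by
  ext ρ μ
  simp only [christoffelMat, christoffelLow, Matrix.of_apply, Matrix.mul_apply, christoffel,
    Finset.mul_sum]
  refine Finset.sum_congr rfl fun σ _ => ?_
  ring

/-- Differentiate $g\,g^{-1}=1$; this is why `RegularAt` asks for invertibility in a neighbourhood
and not only at the point. -/
lemma dInv_eq_neg (hg : RegularAt g x) (κ : Fin 4) :
    dInv g x κ = -(gInv g x * dMetric g x κ * gInv g x) := by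
  have h0 : dMetric g x κ * gInv g x + g x * dInv g x κ = 0 := by
    ext μ ν
    have h1 : pd κ (fun y => ∑ ρ, g y μ ρ * gInv g y ρ ν) x = 0 := by
      rw [pd_congr κ (h := fun _ => (1 : Matrix (Fin 4) (Fin 4) ℝ) μ ν), pd_const]
      filter_upwards [hg.mul_inv] with y hy
      rw [← hy, Matrix.mul_apply]
    rw [pd_sum κ fun ρ _ => (hg.diff μ ρ).fun_mul (hg.diffInv ρ ν)] at h1
    simp only [Matrix.add_apply, Matrix.mul_apply, dMetric, dInv, Matrix.of_apply,
      ← Finset.sum_add_distrib, Matrix.zero_apply]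
    rw [← h1]
    exact Finset.sum_congr rfl fun ρ _ => (pd_mul κ (hg.diff μ ρ) (hg.diffInv ρ ν)).symm
  have h2 : g x * dInv g x κ = -(dMetric g x κ * gInv g x) := by
    rw [eq_neg_iff_add_eq_zero, add_comm]; exact h0
  calc dInv g x κ = gInv g x * (g x * dInv g x κ) := by
        rw [← Matrix.mul_assoc, hg.inv_mul_self, Matrix.one_mul]
    _ = _ := by rw [h2, Matrix.mul_neg, Matrix.mul_assoc]

/-- The inverse metric is parallel. -/
lemma dInv_eq (hg : RegularAt g x) (κ : Fin 4) :
    dInv g x κ = -(christoffelMat g x κ * gInv g x)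
      - (christoffelMat g x κ * gInv g x).transpose := by
  rw [hg.dInv_eq_neg, hg.dMetric_eq, christoffelMat_eq]
  simp only [Matrix.transpose_mul, hg.inv_transpose, Matrix.mul_add, Matrix.add_mul]
  rw [Matrix.mul_assoc (gInv g x) (Matrix.transpose _)]
  abel

/-- The metric is parallel. -/
lemma pd_metric (hg : RegularAt g x) (κ μ ν : Fin 4) :
    pd κ (fun y => g y μ ν) x
      = ∑ ρ, (christoffel g x ρ κ μ * g x ρ ν + christoffel g x ρ κ ν * g x μ ρ) := by
  have h : dMetric g x κ
      = g x * christoffelMat g x κ + (g x * christoffelMat g x κ).transpose := by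
    rw [christoffelMat_eq, ← Matrix.mul_assoc, hg.mul_inv_self, Matrix.one_mul, hg.dMetric_eq]
  have h2 := congrFun (congrFun h μ) ν
  simp only [dMetric, Matrix.of_apply, Matrix.add_apply, Matrix.transpose_apply, Matrix.mul_apply,
    christoffelMat, ← Finset.sum_add_distrib] at h2
  rw [h2]
  refine Finset.sum_congr rfl fun ρ _ => ?_
  rw [hg.symm x ν ρ]; ring

lemma pd_inv_metric (hg : RegularAt g x) (κ μ ν : Fin 4) :
    pd κ (fun y => gInv g y μ ν) x
      = -∑ ρ, (christoffel g x μ κ ρ * gInv g x ρ ν + christoffel g x ν κ ρ * gInv g x μ ρ) := by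
  have h2 := congrFun (congrFun (hg.dInv_eq κ) μ) ν
  simp only [dInv, Matrix.of_apply, Matrix.sub_apply, Matrix.neg_apply, Matrix.transpose_apply,
    Matrix.mul_apply, christoffelMat] at h2
  rw [h2, Finset.sum_add_distrib, neg_add, sub_eq_add_neg]
  congr 2
  refine Finset.sum_congr rfl fun ρ _ => ?_
  rw [hg.inv_symm x ρ μ]

lemma christoffel_symm (hg : RegularAt g x) (κ μ ν : Fin 4) :
    christoffel g x κ μ ν = christoffel g x κ ν μ := by
  simp only [christoffel]
  congr 1
  refine Finset.sum_congr rfl fun ρ _ => ?_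
  rw [hg.pd_symm ρ μ ν]; ring

end RegularAt

/-! ### The scalar product of covectors -/

section dot

variable (g : MetricField) (x : Pt)

lemma dot_add_left (m m' η : Covec) : dot g x (m + m') η = dot g x m η + dot g x m' η := by
  simp only [dot, ← Finset.sum_add_distrib, Pi.add_apply]
  refine Finset.sum_congr rfl fun μ _ => Finset.sum_congr rfl fun ν _ => by ring

lemma dot_add_right (m η η' : Covec) : dot g x m (η + η') = dot g x m η + dot g x m η' := by
  simp only [dot, ← Finset.sum_add_distrib, Pi.add_apply]
  refine Finset.sum_congr rfl fun μ _ => Finset.sum_congr rfl fun ν _ => by ring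

lemma dot_smul_left (c : ℝ) (m η : Covec) : dot g x (c • m) η = c * dot g x m η := by
  simp only [dot, Finset.mul_sum, Pi.smul_apply, smul_eq_mul]
  refine Finset.sum_congr rfl fun μ _ => Finset.sum_congr rfl fun ν _ => by ring

lemma dot_smul_right (c : ℝ) (m η : Covec) : dot g x m (c • η) = c * dot g x m η := by
  simp only [dot, Finset.mul_sum, Pi.smul_apply, smul_eq_mul]
  refine Finset.sum_congr rfl fun μ _ => Finset.sum_congr rfl fun ν _ => by ring

lemma dot_sub_left (m m' η : Covec) : dot g x (m - m') η = dot g x m η - dot g x m' η := by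
  simp only [dot, ← Finset.sum_sub_distrib, Pi.sub_apply]
  refine Finset.sum_congr rfl fun μ _ => Finset.sum_congr rfl fun ν _ => by ring

lemma dot_sub_right (m η η' : Covec) : dot g x m (η - η') = dot g x m η - dot g x m η' := by
  simp only [dot, ← Finset.sum_sub_distrib, Pi.sub_apply]
  refine Finset.sum_congr rfl fun μ _ => Finset.sum_congr rfl fun ν _ => by ring

end dot

namespace RegularAt

variable {g : MetricField} {x : Pt}

lemma dot_comm (hg : RegularAt g x) (m η : Covec) : dot g x m η = dot g x η m := by
  simp only [dot]
  rw [Finset.sum_comm]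
  refine Finset.sum_congr rfl fun μ _ => Finset.sum_congr rfl fun ν _ => ?_
  rw [hg.inv_symm x ν μ]; ring

lemma differentiableAt_dot (hg : RegularAt g x) {m η : Pt → Covec}
    (hm : ∀ μ, DifferentiableAt ℝ (fun y => m y μ) x)
    (hη : ∀ μ, DifferentiableAt ℝ (fun y => η y μ) x) :
    DifferentiableAt ℝ (fun y => dot g y (m y) (η y)) x := by
  simp only [dot]
  exact DifferentiableAt.fun_sum fun μ _ => DifferentiableAt.fun_sum fun ν _ =>
    ((hg.diffInv μ ν).fun_mul (hm μ)).fun_mul (hη ν)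

/-- The scalar product of covectors obeys the product rule for the covariant derivative. -/
lemma pd_dot (hg : RegularAt g x) {m η : Pt → Covec}
    (hm : ∀ μ, DifferentiableAt ℝ (fun y => m y μ) x)
    (hη : ∀ μ, DifferentiableAt ℝ (fun y => η y μ) x) (κ : Fin 4) :
    pd κ (fun y => dot g y (m y) (η y)) x
      = dot g x (covForm g m x κ) (η x) + dot g x (m x) (covForm g η x κ) := by
  have e : pd κ (fun y => dot g y (m y) (η y)) x
      = ∑ μ, ∑ ν, (pd κ (fun y => gInv g y μ ν) x * m x μ * η x ν
        + gInv g x μ ν * pd κ (fun y => m y μ) x * η x ν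
        + gInv g x μ ν * m x μ * pd κ (fun y => η y ν) x) := by
    simp only [dot]
    rw [pd_sum κ fun μ _ => DifferentiableAt.fun_sum fun ν _ =>
      ((hg.diffInv μ ν).fun_mul (hm μ)).fun_mul (hη ν)]
    refine Finset.sum_congr rfl fun μ _ => ?_
    rw [pd_sum κ fun ν _ => ((hg.diffInv μ ν).fun_mul (hm μ)).fun_mul (hη ν)]
    refine Finset.sum_congr rfl fun ν _ => ?_
    rw [pd_mul κ ((hg.diffInv μ ν).fun_mul (hm μ)) (hη ν), pd_mul κ (hg.diffInv μ ν) (hm μ)]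
    ring
  rw [e]
  simp only [hg.pd_inv_metric, dot, covForm]
  -- The next two identities only rename summation indices: they match the Christoffel terms of
  -- $\partial g^{-1}$ with those of $\mathbf D m$ and $\mathbf D\eta$.
  have s1 : ∑ μ, ∑ ν, ∑ ρ, christoffel g x μ κ ρ * gInv g x ρ ν * m x μ * η x ν
      = ∑ μ, ∑ ν, ∑ ρ, gInv g x μ ν * (christoffel g x ρ κ μ * m x ρ) * η x ν := by
    rw [Finset.sum_comm_cycle]
    conv_rhs => rw [Finset.sum_comm_cycle, Finset.sum_comm]
    rw [Finset.sum_comm]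
    simp only [Fin.sum_univ_four]
    ring
  have s2 : ∑ μ, ∑ ν, ∑ ρ, christoffel g x ν κ ρ * gInv g x μ ρ * m x μ * η x ν
      = ∑ μ, ∑ ν, ∑ ρ, gInv g x μ ν * m x μ * (christoffel g x ρ κ ν * η x ρ) := by
    refine Finset.sum_congr rfl fun μ _ => ?_
    rw [Finset.sum_comm]
    refine Finset.sum_congr rfl fun μ _ => Finset.sum_congr rfl fun ν _ => ?_
    ring
  simp only [mul_sub, sub_mul, add_mul, neg_mul, neg_add, Finset.sum_add_distrib,
    Finset.sum_sub_distrib, Finset.sum_neg_distrib, Finset.mul_sum, Finset.sum_mul, s1, s2]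
  ring

end RegularAt

/-! ### Divergences -/

section divergence

variable {g : MetricField} {x : Pt}

lemma covForm_add {m m' : Pt → Covec} (hm : ∀ μ, DifferentiableAt ℝ (fun y => m y μ) x)
    (hm' : ∀ μ, DifferentiableAt ℝ (fun y => m' y μ) x) (μ ν : Fin 4) :
    covForm g (fun y => m y + m' y) x μ ν = covForm g m x μ ν + covForm g m' x μ ν := by
  simp only [covForm, Pi.add_apply, mul_add, Finset.sum_add_distrib]
  rw [pd_add μ (hm ν) (hm' ν)]; ring

lemma covForm_smul {f : Pt → ℝ} {m : Pt → Covec} (hf : DifferentiableAt ℝ f x)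
    (hm : ∀ μ, DifferentiableAt ℝ (fun y => m y μ) x) (μ ν : Fin 4) :
    covForm g (fun y => f y • m y) x μ ν = dform f x μ * m x ν + f x * covForm g m x μ ν := by
  simp only [covForm, Pi.smul_apply, smul_eq_mul, dform]
  rw [pd_mul μ hf (hm ν), mul_sub, Finset.mul_sum]
  simp only [mul_left_comm]
  ring

lemma divForm_add {m m' : Pt → Covec} (hm : ∀ μ, DifferentiableAt ℝ (fun y => m y μ) x)
    (hm' : ∀ μ, DifferentiableAt ℝ (fun y => m' y μ) x) :
    divForm g (fun y => m y + m' y) x = divForm g m x + divForm g m' x := by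
  simp only [divForm, covForm_add hm hm', mul_add, Finset.sum_add_distrib]

lemma divForm_smul {f : Pt → ℝ} {m : Pt → Covec} (hf : DifferentiableAt ℝ f x)
    (hm : ∀ μ, DifferentiableAt ℝ (fun y => m y μ) x) :
    divForm g (fun y => f y • m y) x = dot g x (dform f x) (m x) + f x * divForm g m x := by
  simp only [divForm, covForm_smul hf hm, dot, mul_add, Finset.sum_add_distrib, Finset.mul_sum]
  congr 1
  all_goals refine Finset.sum_congr rfl fun μ _ => Finset.sum_congr rfl fun ν _ => by ring

lemma divForm_const_smul {m : Pt → Covec} (c : ℝ)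
    (hm : ∀ μ, DifferentiableAt ℝ (fun y => m y μ) x) :
    divForm g (fun y => c • m y) x = c * divForm g m x := by
  rw [divForm_smul (f := fun _ => c) (differentiableAt_const c) hm]
  simp [dot, dform, pd_const]

lemma divForm_sub {m m' : Pt → Covec} (hm : ∀ μ, DifferentiableAt ℝ (fun y => m y μ) x)
    (hm' : ∀ μ, DifferentiableAt ℝ (fun y => m' y μ) x) :
    divForm g (fun y => m y - m' y) x = divForm g m x - divForm g m' x := by
  have h := divForm_add (g := g) hm (m' := fun y => (-1 : ℝ) • m' y)
    (fun μ => (hm' μ).const_smul (-1 : ℝ))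
  rw [divForm_const_smul _ hm'] at h
  simp only [neg_smul, one_smul, ← sub_eq_add_neg] at h
  rw [h]; ring

lemma divTensor_add {S S' : Pt → Tensor2} (hS : ∀ μ ν, DifferentiableAt ℝ (fun y => S y μ ν) x)
    (hS' : ∀ μ ν, DifferentiableAt ℝ (fun y => S' y μ ν) x) (ν : Fin 4) :
    divTensor g (fun y => S y + S' y) x ν = divTensor g S x ν + divTensor g S' x ν := by
  simp only [divTensor, ← Finset.sum_add_distrib]
  refine Finset.sum_congr rfl fun κ _ => Finset.sum_congr rfl fun μ _ => ?_
  simp only [covTensor, Pi.add_apply]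
  rw [pd_add κ (hS μ ν) (hS' μ ν), ← mul_add]
  congr 1
  have : ∀ ρ, christoffel g x ρ κ μ * (S x ρ ν + S' x ρ ν)
      + christoffel g x ρ κ ν * (S x μ ρ + S' x μ ρ)
      = (christoffel g x ρ κ μ * S x ρ ν + christoffel g x ρ κ ν * S x μ ρ)
      + (christoffel g x ρ κ μ * S' x ρ ν + christoffel g x ρ κ ν * S' x μ ρ) := fun ρ => by ring
  simp only [this]
  rw [Finset.sum_add_distrib]
  ring

/-- The divergence of the contraction of a tensor with a vector field. -/
lemma divForm_contract {S : Pt → Tensor2} {X : Pt → Vec}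
    (hS : ∀ μ ν, DifferentiableAt ℝ (fun y => S y μ ν) x)
    (hX : ∀ ν, DifferentiableAt ℝ (fun y => X y ν) x) :
    divForm g (fun y μ => ∑ ν, S y μ ν * X y ν) x
      = ∑ ν, divTensor g S x ν * X x ν
        + ∑ μ, ∑ ν, S x μ ν * ∑ κ, gInv g x κ μ * covVec g X x κ ν := by
  have key : ∀ κ μ, covForm g (fun y μ => ∑ ν, S y μ ν * X y ν) x κ μ
      = ∑ ν, covTensor g S x κ μ ν * X x ν + ∑ ν, S x μ ν * covVec g X x κ ν := by
    intro κ μ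
    simp only [covForm, covTensor, covVec]
    rw [pd_sum κ fun ν _ => (hS μ ν).fun_mul (hX ν)]
    simp only [pd_mul κ (hS μ _) (hX _)]
    have s : ∑ ν, ∑ ρ, christoffel g x ρ κ ν * S x μ ρ * X x ν
        = ∑ ν, ∑ ρ, S x μ ν * (christoffel g x ν κ ρ * X x ρ) := by
      rw [Finset.sum_comm]
      refine Finset.sum_congr rfl fun μ _ => Finset.sum_congr rfl fun ν _ => by ring
    have s' : ∑ ν, ∑ ρ, christoffel g x ρ κ μ * S x ρ ν * X x ν
        = ∑ ρ, ∑ ν, christoffel g x ρ κ μ * (S x ρ ν * X x ν) := by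
      rw [Finset.sum_comm]
      refine Finset.sum_congr rfl fun μ _ => Finset.sum_congr rfl fun ν _ => by ring
    simp only [sub_mul, Finset.sum_mul, add_mul, Finset.sum_add_distrib, Finset.sum_sub_distrib,
      mul_add, Finset.mul_sum, s, s']
    ring
  simp only [divForm, key, divTensor, mul_add, Finset.sum_add_distrib, Finset.mul_sum,
    Finset.sum_mul]
  congr 1
  · rw [Finset.sum_comm_cycle]
    refine Finset.sum_congr rfl fun ν _ => Finset.sum_congr rfl fun κ _ =>
      Finset.sum_congr rfl fun μ _ => by ring
  · rw [← Finset.sum_comm_cycle]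
    simp only [Fin.sum_univ_four]
    ring

end divergence

/-- The energy-momentum tensor `Y_μ Y_ν - ½ g_{μν} Y_α Y^α` of a covector field. -/
def formStress (g : MetricField) (Y : Pt → Covec) (x : Pt) : Tensor2 := fun μ ν =>
  Y x μ * Y x ν - (1 / 2) * g x μ ν * dot g x (Y x) (Y x)

/-- The curl `∂_κ Y_ν - ∂_ν Y_κ` of a covector field, as a covector in the index `κ`. -/
def curl (Y : Pt → Covec) (x : Pt) (ν : Fin 4) : Covec := fun κ =>
  pd κ (fun y => Y y ν) x - pd ν (fun y => Y y κ) x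

namespace RegularAt

variable {g : MetricField} {x : Pt}

lemma differentiableAt_formStress (hg : RegularAt g x) {Y : Pt → Covec}
    (hY : ∀ μ, DifferentiableAt ℝ (fun y => Y y μ) x) (μ ν : Fin 4) :
    DifferentiableAt ℝ (fun y => formStress g Y y μ ν) x :=
  ((hY μ).fun_mul (hY ν)).fun_sub (((hg.diff μ ν).const_mul _).fun_mul (hg.differentiableAt_dot hY hY))

/-- Since the metric is parallel, the derivative falls only on $Y$, and the two halves of $\mathbf
D(Y\cdot Y)$ agree by symmetry. -/
lemma covTensor_formStress (hg : RegularAt g x) {Y : Pt → Covec}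
    (hY : ∀ μ, DifferentiableAt ℝ (fun y => Y y μ) x) (κ μ ν : Fin 4) :
    covTensor g (formStress g Y) x κ μ ν
      = covForm g Y x κ μ * Y x ν + Y x μ * covForm g Y x κ ν
        - g x μ ν * dot g x (Y x) (covForm g Y x κ) := by
  have h := hg.pd_dot hY hY κ
  rw [hg.dot_comm (covForm g Y x κ) (Y x)] at h
  simp only [covTensor, formStress]
  rw [pd_sub κ ((hY μ).fun_mul (hY ν))
      (((hg.diff μ ν).const_mul _).fun_mul (hg.differentiableAt_dot hY hY)),
    pd_mul κ (hY μ) (hY ν), pd_mul κ ((hg.diff μ ν).const_mul _) (hg.differentiableAt_dot hY hY),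
    pd_mul κ (differentiableAt_const _) (hg.diff μ ν), pd_const, hg.pd_metric, h]
  generalize dot g x (Y x) (covForm g Y x κ) = d1
  generalize dot g x (Y x) (Y x) = d2
  simp only [covForm, Fin.sum_univ_four]
  ring

/-- The divergence of the energy-momentum tensor of a covector field. -/
lemma divTensor_formStress (hg : RegularAt g x) {Y : Pt → Covec}
    (hY : ∀ μ, DifferentiableAt ℝ (fun y => Y y μ) x) (ν : Fin 4) :
    divTensor g (formStress g Y) x ν = divForm g Y x * Y x ν + dot g x (curl Y x ν) (Y x) := by
  -- The connection is torsion-free, so the curl may be computed with covariant derivatives.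
  have hc : ∀ κ, curl Y x ν κ = covForm g Y x κ ν - covForm g Y x ν κ := by
    intro κ
    simp only [curl, covForm, hg.christoffel_symm _ κ ν]
    ring
  have hd : ∀ κ, ∑ μ, gInv g x κ μ * g x μ ν = (1 : Matrix (Fin 4) (Fin 4) ℝ) κ ν := by
    intro κ
    rw [← hg.inv_mul_self, Matrix.mul_apply]
  have s1 : ∑ κ, ∑ μ, gInv g x κ μ * (g x μ ν * dot g x (Y x) (covForm g Y x κ))
      = dot g x (covForm g Y x ν) (Y x) := by
    simp only [← mul_assoc, ← Finset.sum_mul, hd, Matrix.one_apply, ite_mul, one_mul, zero_mul,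
      Finset.sum_ite_eq', Finset.mem_univ, if_true]
    exact hg.dot_comm _ _
  simp only [divTensor, hg.covTensor_formStress hY, mul_sub, mul_add, Finset.sum_sub_distrib,
    Finset.sum_add_distrib, s1]
  simp only [dot, hc, divForm, mul_sub, sub_mul, Finset.sum_sub_distrib, Finset.sum_mul]
  have s2 : ∑ κ, ∑ μ, gInv g x κ μ * (covForm g Y x κ μ * Y x ν)
      = ∑ κ, ∑ μ, gInv g x κ μ * covForm g Y x κ μ * Y x ν :=
    Finset.sum_congr rfl fun μ _ => Finset.sum_congr rfl fun ν _ => by ring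
  have s3 : ∑ κ, ∑ μ, gInv g x κ μ * (Y x μ * covForm g Y x κ ν)
      = ∑ κ, ∑ μ, gInv g x κ μ * covForm g Y x κ ν * Y x μ :=
    Finset.sum_congr rfl fun μ _ => Finset.sum_congr rfl fun ν _ => by ring
  rw [s2, s3]; ring

/-- For a symmetric tensor, the contraction with `D^μ X^ν` is half that with the deformation
tensor. -/
lemma sum_mul_deformation (hg : RegularAt g x) {S : Tensor2} (hS : ∀ μ ν, S μ ν = S ν μ)
    (X : Pt → Vec) :
    ∑ μ, ∑ ν, S μ ν * deformation g X x μ ν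
      = 2 * ∑ μ, ∑ ν, S μ ν * ∑ κ, gInv g x κ μ * covVec g X x κ ν := by
  simp only [deformation, Finset.sum_add_distrib, mul_add]
  have : ∑ μ, ∑ ν, S μ ν * ∑ κ, gInv g x ν κ * covVec g X x κ μ
      = ∑ μ, ∑ ν, S μ ν * ∑ κ, gInv g x μ κ * covVec g X x κ ν := by
    rw [Finset.sum_comm]
    refine Finset.sum_congr rfl fun μ _ => Finset.sum_congr rfl fun ν _ => by rw [hS]
  rw [this]
  simp only [hg.inv_symm x _ _]
  have e : ∀ μ ν, ∑ κ, gInv g x μ κ * covVec g X x κ ν = ∑ κ, gInv g x κ μ * covVec g X x κ ν :=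
    fun μ ν => Finset.sum_congr rfl fun κ _ => by rw [hg.inv_symm x μ κ]
  simp only [e]; ring

/-- A coordinate field along which the metric is constant is a Killing field. -/
lemma deformation_eq_zero (hg : RegularAt g x) (τ : Fin 4)
    (hτ : ∀ μ ν, pd τ (fun y => g y μ ν) x = 0) (μ ν : Fin 4) :
    deformation g (fun _ => Pi.single τ 1) x μ ν = 0 := by
  have hc : ∀ κ ν, covVec g (fun _ => Pi.single τ 1) x κ ν
      = (1 / 2) * ∑ ρ, gInv g x ν ρ * (pd κ (fun y => g y τ ρ) x - pd ρ (fun y => g y κ τ) x) := by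
    intro κ ν
    simp only [covVec, pd_const, zero_add, Pi.single_apply, mul_ite, mul_one, mul_zero,
      Finset.sum_ite_eq', Finset.mem_univ, if_true, christoffel, hτ, add_zero]
  simp only [deformation, hc, Finset.sum_add_distrib, Finset.mul_sum]
  -- Exchanging the two summation indices reverses the sign of $\partial_\kappa
  -- g_{\tau\rho}-\partial_\rho g_{\kappa\tau}$, so the two halves of the deformation tensor cancel.
  have : ∑ κ, ∑ ρ, gInv g x ν κ * (1 / 2 * (gInv g x μ ρ * (pd κ (fun y => g y τ ρ) x
        - pd ρ (fun y => g y κ τ) x)))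
      = -∑ κ, ∑ ρ, gInv g x μ κ * (1 / 2 * (gInv g x ν ρ * (pd κ (fun y => g y τ ρ) x
        - pd ρ (fun y => g y κ τ) x))) := by
    rw [Finset.sum_comm, ← Finset.sum_neg_distrib]
    refine Finset.sum_congr rfl fun κ _ => ?_
    rw [← Finset.sum_neg_distrib]
    refine Finset.sum_congr rfl fun ρ _ => ?_
    rw [hg.pd_symm ρ τ κ, hg.pd_symm κ ρ τ]
    ring
  rw [this]; ring

end RegularAt

/-! ### Curls -/

lemma curl_dform {f : Pt → ℝ} {x : Pt} (hf : ContDiffAt ℝ 2 f x) (ν : Fin 4) :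
    curl (dform f) x ν = 0 := by
  funext κ
  simp only [curl, dform, Pi.zero_apply]
  rw [pd_comm hf κ ν, sub_self]

lemma curl_add {m m' : Pt → Covec} {x : Pt} (hm : ∀ μ, DifferentiableAt ℝ (fun y => m y μ) x)
    (hm' : ∀ μ, DifferentiableAt ℝ (fun y => m' y μ) x) (ν : Fin 4) :
    curl (fun y => m y + m' y) x ν = curl m x ν + curl m' x ν := by
  funext κ
  simp only [curl, Pi.add_apply]
  rw [pd_add κ (hm ν) (hm' ν), pd_add ν (hm κ) (hm' κ)]; ring

lemma curl_sub {m m' : Pt → Covec} {x : Pt} (hm : ∀ μ, DifferentiableAt ℝ (fun y => m y μ) x)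
    (hm' : ∀ μ, DifferentiableAt ℝ (fun y => m' y μ) x) (ν : Fin 4) :
    curl (fun y => m y - m' y) x ν = curl m x ν - curl m' x ν := by
  funext κ
  simp only [curl, Pi.sub_apply]
  rw [pd_sub κ (hm ν) (hm' ν), pd_sub ν (hm κ) (hm' κ)]; ring

/-- This is $d(f\,dh)=df\wedge dh$: the second derivatives of $h$ cancel by symmetry. -/
lemma curl_smul_dform {f h : Pt → ℝ} {x : Pt} (hf : DifferentiableAt ℝ f x)
    (hh : ContDiffAt ℝ 2 h x) (ν : Fin 4) :
    curl (fun y => f y • dform h y) x ν = dform h x ν • dform f x - dform f x ν • dform h x := by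
  funext κ
  simp only [curl, Pi.smul_apply, Pi.sub_apply, dform, smul_eq_mul]
  rw [pd_mul κ hf (differentiableAt_pd ν hh), pd_mul ν hf (differentiableAt_pd κ hh),
    pd_comm hh κ ν]
  ring

/-! ### The dominant energy condition -/

/-- The energy-momentum tensor of a covector in Minkowski space, evaluated on two future timelike
vectors with time component `1`. -/
lemma minkowski_energy_pos {v1 v2 v3 w1 w2 w3 y0 y1 y2 y3 : ℝ}
    (hv : v1 ^ 2 + v2 ^ 2 + v3 ^ 2 < 1) (hw : w1 ^ 2 + w2 ^ 2 + w3 ^ 2 < 1)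
    (hy : ¬(y0 = 0 ∧ y1 = 0 ∧ y2 = 0 ∧ y3 = 0)) :
    0 < (y0 + y1 * v1 + y2 * v2 + y3 * v3) * (y0 + y1 * w1 + y2 * w2 + y3 * w3)
      + 1 / 2 * (1 - (v1 * w1 + v2 * w2 + v3 * w3)) * (-y0 ^ 2 + y1 ^ 2 + y2 ^ 2 + y3 ^ 2) := by
  set c := v1 * w1 + v2 * w2 + v3 * w3 with hc
  set p := y1 * v1 + y2 * v2 + y3 * v3 with hp
  set p' := y1 * w1 + y2 * w2 + y3 * w3 with hp'
  set s := v1 ^ 2 + v2 ^ 2 + v3 ^ 2 with hs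
  set s' := w1 ^ 2 + w2 ^ 2 + w3 ^ 2 with hs'
  set n := y1 ^ 2 + y2 ^ 2 + y3 ^ 2 with hn
  have hn0 : 0 ≤ n := by positivity
  have hs0 : 0 ≤ s := by positivity
  have hs0' : 0 ≤ s' := by positivity
  have hc1 : 0 < 1 + c := by
    have : 0 ≤ (v1 + w1) ^ 2 + (v2 + w2) ^ 2 + (v3 + w3) ^ 2 := by positivity
    linarith only [this, hc, hs, hs', hv, hw]
  have hps : p ^ 2 ≤ n * s := by
    have : 0 ≤ (y1 * v2 - y2 * v1) ^ 2 + (y1 * v3 - y3 * v1) ^ 2 + (y2 * v3 - y3 * v2) ^ 2 := by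
      positivity
    rw [hp, hn, hs]; linarith only [this]
  have hps' : p' ^ 2 ≤ n * s' := by
    have : 0 ≤ (y1 * w2 - y2 * w1) ^ 2 + (y1 * w3 - y3 * w1) ^ 2 + (y2 * w3 - y3 * w2) ^ 2 := by
      positivity
    rw [hp', hn, hs']; linarith only [this]
  -- This is the Gram determinant of $y,v,w$, hence the square of their triple product.
  have gram : 0 ≤ n * (s * s' - c ^ 2) - p ^ 2 * s' - p' ^ 2 * s + 2 * c * p * p' := by
    have : n * (s * s' - c ^ 2) - p ^ 2 * s' - p' ^ 2 * s + 2 * c * p * p'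
        = (y1 * (v2 * w3 - v3 * w2) - y2 * (v1 * w3 - v3 * w1) + y3 * (v1 * w2 - v2 * w1)) ^ 2 := by
      rw [hp, hp', hn, hs, hs', hc]; ring
    rw [this]; positivity
  -- Replacing $p^2$ by $ns$ and $p'^2$ by $ns'$ leaves exactly $n(1-s)(1-s')$.
  have rest : n * (1 - s) * (1 - s')
      ≤ n * (1 - s * s') - p ^ 2 * (1 - s') - p' ^ 2 * (1 - s) := by
    linarith only [mul_le_mul_of_nonneg_right hps (sub_nonneg.2 hw.le),
      mul_le_mul_of_nonneg_right hps' (sub_nonneg.2 hv.le)]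
  have key : 0 < (y0 * (1 + c) + (p + p')) ^ 2 + n * (1 - s) * (1 - s') := by
    rcases hn0.eq_or_lt with h | h
    · have e1 : y1 = 0 := pow_eq_zero_iff two_ne_zero |>.1 (le_antisymm
        (by linarith only [h, hn, sq_nonneg y1, sq_nonneg y2, sq_nonneg y3]) (sq_nonneg _))
      have e2 : y2 = 0 := pow_eq_zero_iff two_ne_zero |>.1 (le_antisymm
        (by linarith only [h, hn, sq_nonneg y1, sq_nonneg y2, sq_nonneg y3]) (sq_nonneg _))
      have e3 : y3 = 0 := pow_eq_zero_iff two_ne_zero |>.1 (le_antisymm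
        (by linarith only [h, hn, sq_nonneg y1, sq_nonneg y2, sq_nonneg y3]) (sq_nonneg _))
      have e0 : y0 ≠ 0 := fun e0 => hy ⟨e0, e1, e2, e3⟩
      have : y0 * (1 + c) + (p + p') ≠ 0 := by
        rw [hp, hp', e1, e2, e3]; simp [e0, hc1.ne']
      rw [← h]; positivity
    · have h1 : 0 < n * (1 - s) * (1 - s') :=
        mul_pos (mul_pos h (sub_pos.2 hv)) (sub_pos.2 hw)
      positivity
  -- Multiplication by $2(1+c)>0$ makes the coefficient of $y_0^2$ equal to $(1+c)^2$, so the square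
  -- in $y_0$ can be completed; the remainder is the sum of the two quantities just bounded.
  have tot : 2 * (1 + c) * ((y0 + y1 * v1 + y2 * v2 + y3 * v3) * (y0 + y1 * w1 + y2 * w2 + y3 * w3)
      + 1 / 2 * (1 - c) * (-y0 ^ 2 + y1 ^ 2 + y2 ^ 2 + y3 ^ 2))
      = (y0 * (1 + c) + (p + p')) ^ 2
        + ((n * (s * s' - c ^ 2) - p ^ 2 * s' - p' ^ 2 * s + 2 * c * p * p')
          + (n * (1 - s * s') - p ^ 2 * (1 - s') - p' ^ 2 * (1 - s))) := by
    rw [hn, hp, hp']; ring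
  refine pos_of_mul_pos_right (a := 2 * (1 + c)) ?_ (by positivity)
  rw [tot]; linarith only [key, rest, gram]

/-- The Minkowski metric, of signature `(-, +, +, +)`. -/
def minkowski : Matrix (Fin 4) (Fin 4) ℝ := Matrix.diagonal ![-1, 1, 1, 1]

/-- The energy-momentum tensor of a covector in Minkowski space is positive on future timelike
vectors. -/
lemma minkowski_dominant_energy {X Y y : Fin 4 → ℝ}
    (hX : -X 0 ^ 2 + X 1 ^ 2 + X 2 ^ 2 + X 3 ^ 2 < 0) (hX0 : 0 < X 0)
    (hY : -Y 0 ^ 2 + Y 1 ^ 2 + Y 2 ^ 2 + Y 3 ^ 2 < 0) (hY0 : 0 < Y 0) (hy : y ≠ 0) :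
    0 < (y 0 * X 0 + y 1 * X 1 + y 2 * X 2 + y 3 * X 3)
          * (y 0 * Y 0 + y 1 * Y 1 + y 2 * Y 2 + y 3 * Y 3)
      - 1 / 2 * (-(X 0 * Y 0) + X 1 * Y 1 + X 2 * Y 2 + X 3 * Y 3)
          * (-y 0 ^ 2 + y 1 ^ 2 + y 2 ^ 2 + y 3 ^ 2) := by
  -- The expression is homogeneous of degree one in each vector, so both may be divided by their
  -- time components.
  have norm : ∀ Z : Fin 4 → ℝ, -Z 0 ^ 2 + Z 1 ^ 2 + Z 2 ^ 2 + Z 3 ^ 2 < 0 → 0 < Z 0 →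
      (Z 1 / Z 0) ^ 2 + (Z 2 / Z 0) ^ 2 + (Z 3 / Z 0) ^ 2 < 1 := by
    intro Z hZ hZ0
    rw [div_pow, div_pow, div_pow, ← add_div, ← add_div, div_lt_one (by positivity)]
    linarith
  have hy' : ¬(y 0 = 0 ∧ y 1 = 0 ∧ y 2 = 0 ∧ y 3 = 0) := by
    rintro ⟨h0, h1, h2, h3⟩
    exact hy (by ext i; fin_cases i <;> simp [h0, h1, h2, h3])
  have h := mul_pos (mul_pos hX0 hY0) (minkowski_energy_pos (norm X hX hX0) (norm Y hY hY0) hy')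
  have h0 := hX0.ne'
  have h0' := hY0.ne'
  refine h.trans_eq ?_
  field_simp
  ring

lemma evalTensor_eq_dotProduct (S : Matrix (Fin 4) (Fin 4) ℝ) (X Y : Vec) :
    evalTensor S X Y = X ⬝ᵥ S.mulVec Y := by
  simp only [evalTensor, dotProduct, Matrix.mulVec, Finset.mul_sum]
  refine Finset.sum_congr rfl fun μ _ => Finset.sum_congr rfl fun ν _ => by ring

lemma dot_eq_dotProduct (g : MetricField) (x : Pt) (m η : Covec) :
    dot g x m η = m ⬝ᵥ (gInv g x).mulVec η := by
  simp only [dot, dotProduct, Matrix.mulVec, Finset.mul_sum]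
  refine Finset.sum_congr rfl fun μ _ => Finset.sum_congr rfl fun ν _ => by ring

lemma minkowski_dotProduct (X Y : Fin 4 → ℝ) :
    X ⬝ᵥ minkowski.mulVec Y = -(X 0 * Y 0) + X 1 * Y 1 + X 2 * Y 2 + X 3 * Y 3 := by
  simp [minkowski, Matrix.mulVec_diagonal, dotProduct, Fin.sum_univ_four]

/-- A Lorentzian frame at `x`, in which the time coordinate of a vector is a positive multiple of
its component `X 2`. -/
structure HasFrame (g : MetricField) (x : Pt) : Prop where
  exists_frame : ∃ P R : Matrix (Fin 4) (Fin 4) ℝ, ∃ N : ℝ, 0 < N ∧ P * R = 1 ∧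
    g x = P.transpose * minkowski * P ∧ ∀ X : Vec, P.mulVec X 0 = N * X 2

/-- The dominant energy condition for the energy-momentum tensor of a covector field. -/
lemma HasFrame.formStress_pos {g : MetricField} {x : Pt} (hg : HasFrame g x)
    {X Y : Vec} (hX : inner4 g x X X < 0) (hX0 : 0 < X 2) (hY : inner4 g x Y Y < 0)
    (hY0 : 0 < Y 2) {y : Pt → Covec} (hy : y x ≠ 0) :
    0 < evalTensor (formStress g y x) X Y := by
  obtain ⟨P, R, N, hN, hPR, hgP, hP0⟩ := hg.exists_frame
  have hRP : R * P = 1 := mul_eq_one_comm.mp hPR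
  have hmm : minkowski * minkowski = 1 := by
    rw [minkowski, Matrix.diagonal_mul_diagonal, ← Matrix.diagonal_one]
    congr 1
    funext i
    fin_cases i <;> norm_num
  have hinv : gInv g x = R * minkowski * R.transpose := by
    rw [gInv]
    refine Matrix.inv_eq_right_inv ?_
    rw [hgP]
    calc P.transpose * minkowski * P * (R * minkowski * R.transpose)
        = P.transpose * (minkowski * (P * R) * minkowski) * R.transpose := by
          simp only [Matrix.mul_assoc]
      _ = (R * P).transpose := by
          rw [hPR, Matrix.mul_one, hmm, Matrix.mul_one, Matrix.transpose_mul]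
      _ = 1 := by rw [hRP, Matrix.transpose_one]
  have hin : ∀ V W : Vec, inner4 g x V W = P.mulVec V ⬝ᵥ minkowski.mulVec (P.mulVec W) := by
    intro V W
    rw [inner4, evalTensor_eq_dotProduct, hgP]
    simp only [← Matrix.mulVec_mulVec]
    rw [Matrix.dotProduct_mulVec, Matrix.vecMul_transpose]
  -- The components of the covector in the dual frame; pairings and scalar products then take their
  -- Minkowski form.
  set z : Fin 4 → ℝ := R.transpose.mulVec (y x) with hz
  have hyz : y x = P.transpose.mulVec z := by
    rw [hz, Matrix.mulVec_mulVec, ← Matrix.transpose_mul, hRP, Matrix.transpose_one,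
      Matrix.one_mulVec]
  have hz0 : z ≠ 0 := fun h => hy (by rw [hyz, h, Matrix.mulVec_zero])
  have hdot : dot g x (y x) (y x) = z ⬝ᵥ minkowski.mulVec z := by
    rw [dot_eq_dotProduct, hinv]
    simp only [← Matrix.mulVec_mulVec]
    rw [Matrix.dotProduct_mulVec, ← Matrix.mulVec_transpose]
  have hpair : ∀ V : Vec, y x ⬝ᵥ V = z ⬝ᵥ P.mulVec V := by
    intro V
    rw [hyz, Matrix.dotProduct_mulVec, Matrix.mulVec_transpose]
  have hval : evalTensor (formStress g y x) X Y
      = (y x ⬝ᵥ X) * (y x ⬝ᵥ Y) - 1 / 2 * inner4 g x X Y * dot g x (y x) (y x) := by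
    simp only [evalTensor, formStress, inner4]
    generalize dot g x (y x) (y x) = d
    simp only [dotProduct, Fin.sum_univ_four]
    ring
  rw [hval, hpair, hpair, hin, hdot, minkowski_dotProduct, minkowski_dotProduct]
  have tX : 0 < P.mulVec X 0 := by rw [hP0]; positivity
  have tY : 0 < P.mulVec Y 0 := by rw [hP0]; positivity
  rw [hin, minkowski_dotProduct] at hX hY
  have h := minkowski_dominant_energy (X := P.mulVec X) (Y := P.mulVec Y)
    (by linarith) tX (by linarith) tY hz0
  refine h.trans_eq ?_
  simp only [dotProduct, Fin.sum_univ_four]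
  ring

/-! ### The Kerr metric and its inverse -/

/-- The regular function `(1 - χ²) / Δ`. -/
def kerrU (M a : ℝ) (χ : ℝ → ℝ) (r : ℝ) : ℝ := (1 - χ r ^ 2) / Del M a r

/-- The function `-g(dt₊, dt₊)`. -/
def kerrW (M a : ℝ) (χ : ℝ → ℝ) (x : Pt) : ℝ :=
  (1 + 2 * M * x 1 / qsq a (x 0) (x 1)) * χ (x 1) ^ 2
    + Sigsq M a (x 0) (x 1) * kerrU M a χ (x 1) / qsq a (x 0) (x 1)

/-- The inverse of the Kerr metric. -/
def kerrInv (M a : ℝ) (χ : ℝ → ℝ) : MetricField := fun x =>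
  let r := x 1
  let q2 := qsq a (x 0) r
  let h23 := 2 * M * r * χ r / q2
  let h24 := a * χ r / q2
  let h34 := -(2 * M * r * a * kerrU M a χ r / q2)
  let h44 := 1 / (q2 * Real.sin (x 0) ^ 2) - a ^ 2 * kerrU M a χ r / q2
  !![1 / q2, 0, 0, 0;
     0, Del M a r / q2, h23, h24;
     0, h23, -kerrW M a χ x, h34;
     0, h24, h34, h44]

section region

variable {M a : ℝ} {χ : ℝ → ℝ} {x : Pt}

/-- From $\Delta=(r-M)^2-(M^2-a^2)$. -/
lemma del_pos {r : ℝ} (ha : |a| ≤ M) (hr : rHor M a < r) : 0 < Del M a r := by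
  have h0 : 0 ≤ M ^ 2 - a ^ 2 := by
    have := sq_le_sq' (by linarith [abs_nonneg a]) ha
    rw [sq_abs] at this; linarith
  have h1 := Real.sq_sqrt h0
  have h2 := Real.sqrt_nonneg (M ^ 2 - a ^ 2)
  simp only [rHor] at hr
  simp only [Del]
  nlinarith

lemma qsq_pos (hx : x ∈ kerrRegion M a χ) : 0 < qsq a (x 0) (x 1) := by
  have := hx.1
  simp only [qsq]; positivity

lemma sin_sq_pos (hx : x ∈ kerrRegion M a χ) : 0 < Real.sin (x 0) ^ 2 := by
  have := hx.2.1
  positivity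

lemma Sigsq_pos (hM : 0 < M) (hx : x ∈ kerrRegion M a χ) : 0 < Sigsq M a (x 0) (x 1) := by
  have := hx.1
  have := qsq_pos hx
  simp only [Sigsq]; positivity

/-- Where $\Delta$ may vanish, $\chi=1$ and both sides are $0$. With this relation the later algebra
eliminates $\chi^2$ and never divides by $\Delta$, so it is valid across the horizon. -/
lemma del_mul_kerrU (ha : |a| ≤ M) (hx : x ∈ kerrRegion M a χ) :
    Del M a (x 1) * kerrU M a χ (x 1) = 1 - χ (x 1) ^ 2 := by
  simp only [kerrU]
  rcases hx.2.2 with h | h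
  · exact mul_div_cancel₀ _ (del_pos ha h).ne'
  · rw [h.self_of_nhds]; simp

lemma kerrU_nonneg (ha : |a| ≤ M) (hχ : ∀ r, 0 ≤ χ r ∧ χ r ≤ 1) (hx : x ∈ kerrRegion M a χ) :
    0 ≤ kerrU M a χ (x 1) := by
  simp only [kerrU]
  rcases hx.2.2 with h | h
  · refine div_nonneg ?_ (del_pos ha h).le
    nlinarith [hχ (x 1)]
  · rw [h.self_of_nhds]; simp

/-- Both summands are nonnegative. If the one with `kerrU` vanishes, then $\chi^2=1$ and the other
is positive. -/
lemma kerrW_pos (hM : 0 < M) (ha : |a| ≤ M) (hχ : ∀ r, 0 ≤ χ r ∧ χ r ≤ 1)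
    (hx : x ∈ kerrRegion M a χ) : 0 < kerrW M a χ x := by
  have hr := hx.1
  have hq := qsq_pos hx
  have hS := Sigsq_pos hM hx
  have hu := kerrU_nonneg ha hχ hx
  simp only [kerrW]
  rcases hu.eq_or_lt with h | h
  · have h1 := del_mul_kerrU ha hx
    rw [← h, mul_zero] at h1
    rw [← h, show χ (x 1) ^ 2 = 1 by linarith]
    simp only [mul_one, mul_zero, zero_div, add_zero]
    positivity
  · positivity

/-- Openness holds because $\chi=1$ is required in a neighbourhood; it allows pointwise identities
on the region to be differentiated. -/
lemma isOpen_kerrRegion (M a : ℝ) (χ : ℝ → ℝ) : IsOpen (kerrRegion M a χ) := by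
  have h1 : Continuous fun y : Pt => y 1 := continuous_apply 1
  refine (isOpen_lt continuous_const h1).inter (IsOpen.inter ?_ (IsOpen.union ?_ ?_))
  · exact isOpen_ne_fun (Real.continuous_sin.comp (continuous_apply 0)) continuous_const
  · exact isOpen_lt continuous_const h1
  · exact (isOpen_setOfPred_eventually_nhds (p := fun s => χ s = 1)).preimage h1

/-- Either $\Delta>0$ and the quotient is regular, or $\chi=1$ near $r$ and the function is locally
zero, whatever $\Delta$ does. -/
lemma differentiableAt_kerrU (ha : |a| ≤ M) (hχ : ContDiff ℝ ∞ χ) (hx : x ∈ kerrRegion M a χ) :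
    DifferentiableAt ℝ (kerrU M a χ) (x 1) := by
  have hd : Differentiable ℝ χ := hχ.differentiable (by norm_num)
  rcases hx.2.2 with h | h
  · have h0 := (del_pos ha h).ne'
    unfold kerrU
    refine DifferentiableAt.fun_div (by fun_prop) ?_ h0
    unfold Del; fun_prop
  · have : kerrU M a χ =ᶠ[𝓝 (x 1)] fun _ => 0 := by
      filter_upwards [h] with s hs
      simp [kerrU, hs]
    exact (differentiableAt_const 0).congr_of_eventuallyEq this

/-- The components of the Kerr metric without division by `Δ`. -/
lemma kerrMetric_eq (M a : ℝ) (χ : ℝ → ℝ) (x : Pt) : kerrMetric M a χ x =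
    !![qsq a (x 0) (x 1), 0, 0, 0;
      0, qsq a (x 0) (x 1) * kerrU M a χ (x 1)
          + (2 * M * x 1 + qsq a (x 0) (x 1)) / qsq a (x 0) (x 1) * χ (x 1) ^ 2,
        χ (x 1) * (2 * M * x 1 / qsq a (x 0) (x 1)),
        -(χ (x 1) * (a * Real.sin (x 0) ^ 2 * (qsq a (x 0) (x 1) + 2 * M * x 1)
          / qsq a (x 0) (x 1)));
      0, χ (x 1) * (2 * M * x 1 / qsq a (x 0) (x 1)),
        (2 * M * x 1 - qsq a (x 0) (x 1)) / qsq a (x 0) (x 1),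
        -(2 * a * M * x 1 * Real.sin (x 0) ^ 2 / qsq a (x 0) (x 1));
      0, -(χ (x 1) * (a * Real.sin (x 0) ^ 2 * (qsq a (x 0) (x 1) + 2 * M * x 1)
          / qsq a (x 0) (x 1))),
        -(2 * a * M * x 1 * Real.sin (x 0) ^ 2 / qsq a (x 0) (x 1)),
        Sigsq M a (x 0) (x 1) * Real.sin (x 0) ^ 2 / qsq a (x 0) (x 1)] := by
  have : qsq a (x 0) (x 1) / Del M a (x 1) * (1 - χ (x 1) ^ 2)
      = qsq a (x 0) (x 1) * kerrU M a χ (x 1) := by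
    simp only [kerrU]; ring
  simp only [kerrMetric, this]

lemma qsq_eq (a θ r : ℝ) : qsq a θ r = r ^ 2 + a ^ 2 - a ^ 2 * Real.sin θ ^ 2 := by
  simp only [qsq, Real.sin_sq]; ring

/-- Writing $u$ for `kerrU`, the entries are rational identities modulo two relations:
$\chi^2=1-\Delta u$ and $q^2=r^2+a^2-a^2\sin^2\theta$. -/
lemma kerrMetric_mul_kerrInv (ha : |a| ≤ M) (hx : x ∈ kerrRegion M a χ) :
    kerrMetric M a χ x * kerrInv M a χ x = 1 := by
  have hq := (qsq_pos hx).ne'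
  have hs := (sin_sq_pos hx).ne'
  have hu := del_mul_kerrU ha hx
  have hqe := qsq_eq a (x 0) (x 1)
  rw [kerrMetric_eq]
  simp only [kerrInv, kerrW, Sigsq]
  simp only [Del] at hu ⊢
  generalize kerrU M a χ (x 1) = u at *
  generalize χ (x 1) = k at *
  generalize x 1 = r at *
  generalize qsq a (x 0) r = q at *
  generalize Real.sin (x 0) ^ 2 = s at *
  have hk : k ^ 2 = 1 - (r ^ 2 + a ^ 2 - 2 * M * r) * u := by linarith
  ext i j
  fin_cases i <;> fin_cases j <;>
    simp [Matrix.mul_apply, Fin.sum_univ_four] <;> field_simp <;>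
    (try simp only [hk]) <;> rw [hqe] <;> ring

end region

/-! ### Regularity, block determinants and a Lorentzian frame for Kerr -/

section regular

variable {M a : ℝ} {χ : ℝ → ℝ} {x : Pt}

lemma eventually_mem_kerrRegion (hx : x ∈ kerrRegion M a χ) : ∀ᶠ y in 𝓝 x, y ∈ kerrRegion M a χ :=
  (isOpen_kerrRegion M a χ).mem_nhds hx

lemma gInv_kerr (ha : |a| ≤ M) (hx : x ∈ kerrRegion M a χ) :
    gInv (kerrMetric M a χ) x = kerrInv M a χ x :=
  Matrix.inv_eq_right_inv (kerrMetric_mul_kerrInv ha hx)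

lemma kerrMetric_symm (M a : ℝ) (χ : ℝ → ℝ) (x : Pt) (μ ν : Fin 4) :
    kerrMetric M a χ x μ ν = kerrMetric M a χ x ν μ := by
  fin_cases μ <;> fin_cases ν <;> rfl

lemma differentiableAt_qsq (a : ℝ) (x : Pt) :
    DifferentiableAt ℝ (fun y : Pt => qsq a (y 0) (y 1)) x := by
  unfold qsq; fun_prop

lemma differentiableAt_Sigsq (M a : ℝ) (x : Pt) :
    DifferentiableAt ℝ (fun y : Pt => Sigsq M a (y 0) (y 1)) x := by
  unfold Sigsq qsq; fun_prop

lemma differentiableAt_Del (M a : ℝ) (x : Pt) :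
    DifferentiableAt ℝ (fun y : Pt => Del M a (y 1)) x := by
  unfold Del; fun_prop

lemma regularAt_kerr (ha : |a| ≤ M) (hχ : ContDiff ℝ ∞ χ) (hx : x ∈ kerrRegion M a χ) :
    RegularAt (kerrMetric M a χ) x := by
  have hq := (qsq_pos hx).ne'
  have hs := (sin_sq_pos hx).ne'
  have dq := differentiableAt_qsq a x
  have dS := differentiableAt_Sigsq M a x
  have dD := differentiableAt_Del M a x
  have h1 : DifferentiableAt ℝ (fun y : Pt => y 1) x := by fun_prop
  have h0 : DifferentiableAt ℝ (fun y : Pt => y 0) x := by fun_prop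
  have dU := differentiableAt_kerrU ha hχ hx
  have dχ : Differentiable ℝ χ := hχ.differentiable (by norm_num)
  have hqs : qsq a (x 0) (x 1) * Real.sin (x 0) ^ 2 ≠ 0 := mul_ne_zero hq hs
  refine ⟨kerrMetric_symm M a χ, fun μ ν => ?_, fun μ ν => ?_, ?_⟩
  · simp only [kerrMetric_eq]
    fin_cases μ <;> fin_cases ν <;> simp <;> fun_prop (disch := assumption)
  · have e : (fun y => gInv (kerrMetric M a χ) y μ ν) =ᶠ[𝓝 x] fun y => kerrInv M a χ y μ ν := by
      filter_upwards [eventually_mem_kerrRegion hx] with y hy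
      rw [gInv_kerr ha hy]
    refine DifferentiableAt.congr_of_eventuallyEq ?_ e
    fin_cases μ <;> fin_cases ν <;> simp [kerrInv, kerrW] <;> fun_prop (disch := assumption)
  · filter_upwards [eventually_mem_kerrRegion hx] with y hy
    rw [gInv_kerr ha hy, kerrMetric_mul_kerrInv ha hy]

/-- A block metric `(θ) ⊕ (r, t, φ)` whose `(r, φ)` block is positive definite and whose
determinant is negative has a Lorentzian frame. -/
lemma hasFrame_of_block {g : MetricField} {x : Pt} {q b c d e f h : ℝ}
    (hg : g x = !![q, 0, 0, 0; 0, b, c, d; 0, c, e, f; 0, d, f, h])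
    (hq : 0 < q) (hh : 0 < h) (hD : 0 < b * h - d ^ 2)
    (hdet : b * (e * h - f ^ 2) - c * (c * h - f * d) + d * (c * f - e * d) < 0) :
    HasFrame g x := by
  set D := b * h - d ^ 2 with hDd
  set det := b * (e * h - f ^ 2) - c * (c * h - f * d) + d * (c * f - e * d) with hdetd
  obtain ⟨m, hm, hm2⟩ : ∃ m, 0 < m ∧ m ^ 2 = q := ⟨√q, Real.sqrt_pos.2 hq, Real.sq_sqrt hq.le⟩
  obtain ⟨l, hl, hl2⟩ : ∃ m, 0 < m ∧ m ^ 2 = h := ⟨√h, Real.sqrt_pos.2 hh, Real.sq_sqrt hh.le⟩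
  have hk0 : 0 < D / h := div_pos hD hh
  obtain ⟨k, hk, hk2⟩ : ∃ m, 0 < m ∧ m ^ 2 = D / h :=
    ⟨√(D / h), Real.sqrt_pos.2 hk0, Real.sq_sqrt hk0.le⟩
  have hn0 : 0 < -det / D := div_pos (neg_pos.2 hdet) hD
  obtain ⟨n, hn, hn2⟩ : ∃ m, 0 < m ∧ m ^ 2 = -det / D :=
    ⟨√(-det / D), Real.sqrt_pos.2 hn0, Real.sq_sqrt hn0.le⟩
  have hh0 := hh.ne'
  have hD0 := hD.ne'
  obtain ⟨d', hd'⟩ : ∃ d', d = d' * l := ⟨d / l, (div_mul_cancel₀ _ hl.ne').symm⟩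
  obtain ⟨f', hf'⟩ : ∃ f', f = f' * l := ⟨f / l, (div_mul_cancel₀ _ hl.ne').symm⟩
  obtain ⟨β, hβ⟩ : ∃ β, β = (c * h - d * f) / D := ⟨_, rfl⟩
  -- The rows come from completing squares in the quadratic form, first in $d\phi_+$ (coefficient
  -- $h$), then in $dr$ (coefficient $D/h$). What is left on $dt_+^2$ is $\det/D<0$, so the time
  -- covector of the frame is $n\,dt_+$.
  set P : Matrix (Fin 4) (Fin 4) ℝ :=
    !![0, 0, n, 0; m, 0, 0, 0; 0, k, k * β, 0; 0, d', f', l] with hP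
  have hgP : g x = P.transpose * minkowski * P := by
    have hdd : d ^ 2 = d' ^ 2 * h := by rw [hd', ← hl2]; ring
    have hff : f ^ 2 = f' ^ 2 * h := by rw [hf', ← hl2]; ring
    have hdf : d * f = d' * f' * h := by rw [hd', hf', ← hl2]; ring
    have e1 : b = k ^ 2 + d' ^ 2 := by
      rw [hk2, hDd]; field_simp; linear_combination hdd
    have e2 : c = k ^ 2 * β + d' * f' := by
      rw [hk2, hβ]; field_simp; linear_combination hdf
    have e3 : e = -n ^ 2 + k ^ 2 * β ^ 2 + f' ^ 2 := by
      have : f' ^ 2 = f ^ 2 / h := by rw [hff]; field_simp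
      rw [hk2, hβ, hn2, this]; field_simp; rw [hdetd, hDd]; ring
    rw [hg]
    ext i j
    fin_cases i <;> fin_cases j <;>
      simp [hP, minkowski, Matrix.mul_apply, Fin.sum_univ_four, Matrix.diagonal]
    · linear_combination -hm2
    · linear_combination e1
    · linear_combination e2
    · exact hd'
    · linear_combination e2
    · linear_combination e3
    · exact hf'
    · linear_combination hd'
    · linear_combination hf'
    · linear_combination -hl2
  have hPR : P * P⁻¹ = 1 := by
    refine Matrix.mul_nonsing_inv _ ?_
    rw [isUnit_iff_ne_zero]
    have : P.det = n * m * k * l := by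
      simp [hP, Matrix.det_succ_row_zero, Fin.sum_univ_succ, Fin.succAbove]
      ring
    rw [this]; positivity
  refine ⟨P, P⁻¹, n, hn, hPR, hgP, fun X => ?_⟩
  simp [hP, Matrix.mulVec, dotProduct, Fin.sum_univ_four]

/-- The determinant of the `(r, t₊, φ₊)` block of the Kerr metric. -/
lemma kerr_block_det (ha : |a| ≤ M) (hx : x ∈ kerrRegion M a χ) :
    kerrMetric M a χ x 1 1 * (kerrMetric M a χ x 2 2 * kerrMetric M a χ x 3 3
        - kerrMetric M a χ x 2 3 ^ 2)
      - kerrMetric M a χ x 1 2 * (kerrMetric M a χ x 1 2 * kerrMetric M a χ x 3 3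
        - kerrMetric M a χ x 2 3 * kerrMetric M a χ x 1 3)
      + kerrMetric M a χ x 1 3 * (kerrMetric M a χ x 1 2 * kerrMetric M a χ x 2 3
        - kerrMetric M a χ x 2 2 * kerrMetric M a χ x 1 3)
      = -(qsq a (x 0) (x 1) * Real.sin (x 0) ^ 2) := by
  have hq := (qsq_pos hx).ne'
  have hu := del_mul_kerrU ha hx
  have hqe := qsq_eq a (x 0) (x 1)
  rw [kerrMetric_eq]
  simp [Sigsq]
  simp only [Del] at hu ⊢
  generalize kerrU M a χ (x 1) = u at *
  generalize χ (x 1) = k at *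
  generalize x 1 = r at *
  generalize qsq a (x 0) r = q at *
  generalize Real.sin (x 0) ^ 2 = s at *
  have hk : k ^ 2 = 1 - (r ^ 2 + a ^ 2 - 2 * M * r) * u := by linarith
  field_simp
  simp only [hk]
  rw [hqe]
  ring

/-- The cofactor belonging to $g^{t_+t_+}=-W$, with $W$ standing for `kerrW`. Its positivity makes
the slices $t_+=\mathrm{const}$ spacelike. -/
lemma kerr_rphi_det (ha : |a| ≤ M) (hx : x ∈ kerrRegion M a χ) :
    kerrMetric M a χ x 1 1 * kerrMetric M a χ x 3 3 - kerrMetric M a χ x 1 3 ^ 2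
      = Real.sin (x 0) ^ 2 * qsq a (x 0) (x 1) * kerrW M a χ x := by
  have hq := (qsq_pos hx).ne'
  have hu := del_mul_kerrU ha hx
  have hqe := qsq_eq a (x 0) (x 1)
  rw [kerrMetric_eq]
  simp [Sigsq, kerrW]
  simp only [Del] at hu ⊢
  generalize kerrU M a χ (x 1) = u at *
  generalize χ (x 1) = k at *
  generalize x 1 = r at *
  generalize qsq a (x 0) r = q at *
  generalize Real.sin (x 0) ^ 2 = s at *
  have hk : k ^ 2 = 1 - (r ^ 2 + a ^ 2 - 2 * M * r) * u := by linarith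
  field_simp
  simp only [hk]
  rw [hqe]
  ring

/-- The orbits of $\mathbf T,\mathbf Z$ are therefore timelike surfaces exactly where $\Delta>0$;
the expression does not involve $\chi$. -/
lemma kerr_tphi_det (hx : x ∈ kerrRegion M a χ) :
    kerrMetric M a χ x 2 2 * kerrMetric M a χ x 3 3 - kerrMetric M a χ x 2 3 ^ 2
      = -(Del M a (x 1) * Real.sin (x 0) ^ 2) := by
  have hq := (qsq_pos hx).ne'
  have hqe := qsq_eq a (x 0) (x 1)
  rw [kerrMetric_eq]
  simp [Sigsq, Del]
  generalize x 1 = r at *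
  generalize qsq a (x 0) r = q at *
  generalize Real.sin (x 0) ^ 2 = s at *
  field_simp
  rw [hqe]
  ring

lemma ernstA_pos (hM : 0 < M) (hx : x ∈ kerrRegion M a χ) : 0 < ernstA M a x :=
  div_pos (mul_pos (Sigsq_pos hM hx) (sin_sq_pos hx)) (qsq_pos hx)

lemma hasFrame_kerr (hM : 0 < M) (ha : |a| ≤ M) (hχ : ∀ r, 0 ≤ χ r ∧ χ r ≤ 1)
    (hx : x ∈ kerrRegion M a χ) : HasFrame (kerrMetric M a χ) x := by
  have hq := qsq_pos hx
  have hs := sin_sq_pos hx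
  have hW := kerrW_pos hM ha hχ hx
  refine hasFrame_of_block (g := kerrMetric M a χ) (q := kerrMetric M a χ x 0 0)
    (b := kerrMetric M a χ x 1 1) (c := kerrMetric M a χ x 1 2) (d := kerrMetric M a χ x 1 3)
    (e := kerrMetric M a χ x 2 2) (f := kerrMetric M a χ x 2 3) (h := kerrMetric M a χ x 3 3)
    rfl hq (ernstA_pos hM hx) ?_ ?_
  · rw [kerr_rphi_det ha hx]; positivity
  · rw [kerr_block_det ha hx, neg_lt_zero]; positivity

end regular

/-! ### Contracted Christoffel symbols and the wave operator -/

/-- The contracted derivative `g^{μν} ∂_ρ g_{μν}` of the metric. -/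
def metricTrace (g : MetricField) (x : Pt) (ρ : Fin 4) : ℝ :=
  ∑ μ, ∑ ν, gInv g x μ ν * pd ρ (fun y => g y μ ν) x

/-- The contracted Christoffel symbols `g^{μν} Γ^κ_{μν}`. -/
def christoffelTrace (g : MetricField) (x : Pt) (κ : Fin 4) : ℝ :=
  ∑ μ, ∑ ν, gInv g x μ ν * christoffel g x κ μ ν

/-- Expand $\partial g$ by metric compatibility; each of its two terms contracts to
$\Gamma^\mu_{\mu\rho}$. -/
lemma RegularAt.metricTrace_eq {g : MetricField} {x : Pt} (hg : RegularAt g x) (ρ : Fin 4) :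
    metricTrace g x ρ = 2 * ∑ μ, christoffel g x μ μ ρ := by
  have hd : ∀ κ ν, ∑ μ, gInv g x κ μ * g x μ ν = (1 : Matrix (Fin 4) (Fin 4) ℝ) κ ν := by
    intro κ ν
    rw [← hg.inv_mul_self, Matrix.mul_apply]
  have s1 : ∑ μ, ∑ ν, ∑ σ, gInv g x μ ν * (christoffel g x σ ρ μ * g x σ ν)
      = ∑ μ, christoffel g x μ μ ρ := by
    have : ∀ μ σ, ∑ ν, gInv g x μ ν * (christoffel g x σ ρ μ * g x σ ν)
        = christoffel g x σ ρ μ * (1 : Matrix (Fin 4) (Fin 4) ℝ) μ σ := by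
      intro μ σ
      rw [← hd, Finset.mul_sum]
      refine Finset.sum_congr rfl fun ν _ => ?_
      rw [hg.symm x σ ν]; ring
    refine Finset.sum_congr rfl fun μ _ => ?_
    rw [Finset.sum_comm]
    simp only [this, Matrix.one_apply, mul_ite, mul_one, mul_zero, Finset.sum_ite_eq,
      Finset.mem_univ, if_true, hg.christoffel_symm μ ρ μ]
  have s2 : ∑ μ, ∑ ν, ∑ σ, gInv g x μ ν * (christoffel g x σ ρ ν * g x μ σ)
      = ∑ μ, christoffel g x μ μ ρ := by
    rw [← s1, Finset.sum_comm]
    refine Finset.sum_congr rfl fun μ _ => Finset.sum_congr rfl fun ν _ =>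
      Finset.sum_congr rfl fun σ _ => ?_
    rw [hg.inv_symm x ν μ, hg.symm x ν σ]
  simp only [metricTrace, hg.pd_metric, Finset.mul_sum, mul_add, Finset.sum_add_distrib, s1, s2]
  rw [← Finset.mul_sum]; ring

/-- Contract the formula for $\partial g^{-1}$. The trace entering $\square$ is thus found from the
inverse metric and the logarithmic derivative of the determinant, without the individual Christoffel
symbols of Kerr. -/
lemma RegularAt.christoffelTrace_eq {g : MetricField} {x : Pt} (hg : RegularAt g x) (κ : Fin 4) :
    christoffelTrace g x κ = -∑ μ, pd μ (fun y => gInv g y κ μ) x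
      - (1 / 2) * ∑ ρ, gInv g x κ ρ * metricTrace g x ρ := by
  simp only [hg.metricTrace_eq, hg.pd_inv_metric, christoffelTrace, Finset.sum_add_distrib,
    Finset.sum_neg_distrib]
  have s1 : ∑ μ, ∑ ρ, christoffel g x κ μ ρ * gInv g x ρ μ
      = ∑ μ, ∑ ν, gInv g x μ ν * christoffel g x κ μ ν :=
    Finset.sum_congr rfl fun μ _ => Finset.sum_congr rfl fun ν _ => by
      rw [hg.inv_symm x ν μ]; ring
  have s2 : ∑ μ, ∑ ρ, christoffel g x μ μ ρ * gInv g x κ ρ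
      = (1 / 2) * ∑ ρ, gInv g x κ ρ * (2 * ∑ μ, christoffel g x μ μ ρ) := by
    rw [Finset.sum_comm, Finset.mul_sum]
    refine Finset.sum_congr rfl fun ρ _ => ?_
    rw [← Finset.sum_mul]; ring
  rw [s1, s2]; ring

lemma box_eq (g : MetricField) (f : Pt → ℝ) (x : Pt) :
    box g f x = ∑ μ, ∑ ν, gInv g x μ ν * pd μ (fun y => pd ν f y) x
      - ∑ κ, christoffelTrace g x κ * pd κ f x := by
  have s : ∑ κ, christoffelTrace g x κ * pd κ f x
      = ∑ μ, ∑ ν, gInv g x μ ν * ∑ κ, christoffel g x κ μ ν * pd κ f x := by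
    simp only [christoffelTrace, Finset.sum_mul, Finset.mul_sum]
    rw [Finset.sum_comm]
    refine Finset.sum_congr rfl fun μ _ => ?_
    rw [Finset.sum_comm]
    refine Finset.sum_congr rfl fun ν _ => Finset.sum_congr rfl fun κ _ => by ring
  rw [s]
  simp only [box, divForm, covForm, dform, mul_sub, Finset.sum_sub_distrib]

/-! ### Functions of `θ` and `r` -/

lemma pd_eq_zero_of_update {f : Pt → ℝ} {x : Pt} (μ : Fin 4)
    (h : ∀ y t, f (Function.update y μ t) = f y) : pd μ f x = 0 := by
  by_cases hf : DifferentiableAt ℝ f x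
  · have h1 := hasDerivAt_pd μ hf
    simp only [h] at h1
    exact h1.unique (hasDerivAt_const _ _)
  -- At a point of non-differentiability `fderiv` is zero by convention.
  · simp [pd, fderiv_zero_of_not_differentiableAt hf]

lemma pd_two_eq_zero (F : ℝ → ℝ → ℝ) (x : Pt) : pd 2 (fun y => F (y 0) (y 1)) x = 0 :=
  pd_eq_zero_of_update 2 fun y t => by simp

lemma pd_three_eq_zero (F : ℝ → ℝ → ℝ) (x : Pt) : pd 3 (fun y => F (y 0) (y 1)) x = 0 :=
  pd_eq_zero_of_update 3 fun y t => by simp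

lemma pd_zero_of_hasDerivAt {F : ℝ → ℝ → ℝ} {x : Pt} {c : ℝ}
    (hd : DifferentiableAt ℝ (fun y : Pt => F (y 0) (y 1)) x)
    (h : HasDerivAt (fun t => F t (x 1)) c (x 0)) : pd 0 (fun y => F (y 0) (y 1)) x = c := by
  have h1 := hasDerivAt_pd 0 hd
  simp at h1
  exact h1.unique h

lemma pd_one_of_hasDerivAt {F : ℝ → ℝ → ℝ} {x : Pt} {c : ℝ}
    (hd : DifferentiableAt ℝ (fun y : Pt => F (y 0) (y 1)) x)
    (h : HasDerivAt (fun t => F (x 0) t) c (x 1)) : pd 1 (fun y => F (y 0) (y 1)) x = c := by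
  have h1 := hasDerivAt_pd 1 hd
  simp at h1
  exact h1.unique h

/-! ### The contracted Christoffel symbols of the Kerr metric -/

section kerr

variable {M a : ℝ} {χ : ℝ → ℝ} {x : Pt}

lemma pd_two_kerrMetric (M a : ℝ) (χ : ℝ → ℝ) (x : Pt) (μ ν : Fin 4) :
    pd 2 (fun y => kerrMetric M a χ y μ ν) x = 0 :=
  pd_eq_zero_of_update 2 fun y t => by simp [kerrMetric]

lemma pd_three_kerrMetric (M a : ℝ) (χ : ℝ → ℝ) (x : Pt) (μ ν : Fin 4) :
    pd 3 (fun y => kerrMetric M a χ y μ ν) x = 0 :=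
  pd_eq_zero_of_update 3 fun y t => by simp [kerrMetric]

lemma pd_gInv_kerr (ha : |a| ≤ M) (hx : x ∈ kerrRegion M a χ) (κ μ ν : Fin 4) :
    pd κ (fun y => gInv (kerrMetric M a χ) y μ ν) x = pd κ (fun y => kerrInv M a χ y μ ν) x := by
  refine pd_congr κ ?_
  filter_upwards [eventually_mem_kerrRegion hx] with y hy
  rw [gInv_kerr ha hy]

/-- The inverse of the `(r, t₊, φ₊)` block of the Kerr metric through its cofactors. -/
lemma kerrInv_cofactors (ha : |a| ≤ M) (hx : x ∈ kerrRegion M a χ) :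
    let g := kerrMetric M a χ x
    let h := kerrInv M a χ x
    let d := -(qsq a (x 0) (x 1) * Real.sin (x 0) ^ 2)
    h 1 1 * d = g 2 2 * g 3 3 - g 2 3 ^ 2 ∧ h 1 2 * d = g 2 3 * g 1 3 - g 1 2 * g 3 3 ∧
    h 1 3 * d = g 1 2 * g 2 3 - g 2 2 * g 1 3 ∧ h 2 2 * d = g 1 1 * g 3 3 - g 1 3 ^ 2 ∧
    h 2 3 * d = g 1 2 * g 1 3 - g 1 1 * g 2 3 ∧ h 3 3 * d = g 1 1 * g 2 2 - g 1 2 ^ 2 := by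
  have hq := (qsq_pos hx).ne'
  have hs := (sin_sq_pos hx).ne'
  have hu := del_mul_kerrU ha hx
  have hqe := qsq_eq a (x 0) (x 1)
  intro g h d
  refine ⟨?_, ?_, ?_, ?_, ?_, ?_⟩
  · rw [kerr_tphi_det hx]
    simp [h, d, kerrInv]
    field_simp
  -- Brings forward the cofactor of $g_{t_+t_+}$, which, like the first one, is an already computed
  -- determinant.
  rotate_left 2
  · rw [kerr_rphi_det ha hx]
    simp [h, d, kerrInv]
    ring
  all_goals
    simp only [g, h, d]
    rw [kerrMetric_eq]
    simp [kerrInv, Sigsq]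
    simp only [Del] at hu ⊢
    generalize kerrU M a χ (x 1) = u at *
    generalize χ (x 1) = k at *
    generalize x 1 = r at *
    generalize qsq a (x 0) r = q at *
    generalize Real.sin (x 0) ^ 2 = s at *
    have hk : k ^ 2 = 1 - (r ^ 2 + a ^ 2 - 2 * M * r) * u := by linarith
    field_simp
    try simp only [hk]
    rw [hqe]
    ring

/-- The derivative of the determinant of the Kerr metric. -/
lemma metricTrace_kerr (ha : |a| ≤ M) (hχ : ContDiff ℝ ∞ χ) (hx : x ∈ kerrRegion M a χ)
    (ρ : Fin 4) : metricTrace (kerrMetric M a χ) x ρ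
      = pd ρ (fun y => qsq a (y 0) (y 1)) x / qsq a (x 0) (x 1)
        + pd ρ (fun y => qsq a (y 0) (y 1) * Real.sin (y 0) ^ 2) x
          / (qsq a (x 0) (x 1) * Real.sin (x 0) ^ 2) := by
  have hq := (qsq_pos hx).ne'
  have hs := (sin_sq_pos hx).ne'
  have hqs := mul_ne_zero hq hs
  have hg := regularAt_kerr ha hχ hx
  have hcof := kerrInv_cofactors ha hx
  -- Jacobi's formula by hand: differentiate the known block determinant, then recognize its
  -- cofactors as entries of the inverse times the determinant.
  have hdet : pd ρ (fun y => kerrMetric M a χ y 1 1 * (kerrMetric M a χ y 2 2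
        * kerrMetric M a χ y 3 3 - kerrMetric M a χ y 2 3 ^ 2)
      - kerrMetric M a χ y 1 2 * (kerrMetric M a χ y 1 2 * kerrMetric M a χ y 3 3
        - kerrMetric M a χ y 2 3 * kerrMetric M a χ y 1 3)
      + kerrMetric M a χ y 1 3 * (kerrMetric M a χ y 1 2 * kerrMetric M a χ y 2 3
        - kerrMetric M a χ y 2 2 * kerrMetric M a χ y 1 3)) x
      = pd ρ (fun y => -1 * (qsq a (y 0) (y 1) * Real.sin (y 0) ^ 2)) x := by
    refine pd_congr ρ ?_
    filter_upwards [eventually_mem_kerrRegion hx] with y hy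
    rw [kerr_block_det ha hy]; ring
  have dqs : DifferentiableAt ℝ (fun y : Pt => qsq a (y 0) (y 1) * Real.sin (y 0) ^ 2) x := by
    unfold qsq; fun_prop
  rw [pd_mul ρ (differentiableAt_const _) dqs, pd_const] at hdet
  have d11 := hg.diff 1 1
  have d12 := hg.diff 1 2
  have d13 := hg.diff 1 3
  have d22 := hg.diff 2 2
  have d23 := hg.diff 2 3
  have d33 := hg.diff 3 3
  simp only [pow_two] at hdet
  rw [pd_add ρ (by fun_prop) (by fun_prop), pd_sub ρ (by fun_prop) (by fun_prop),
    pd_mul ρ d11 (by fun_prop), pd_mul ρ d12 (by fun_prop), pd_mul ρ d13 (by fun_prop),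
    pd_sub ρ (by fun_prop) (by fun_prop), pd_sub ρ (by fun_prop) (by fun_prop),
    pd_sub ρ (by fun_prop) (by fun_prop), pd_mul ρ d22 d33, pd_mul ρ d23 d23, pd_mul ρ d12 d33,
    pd_mul ρ d23 d13, pd_mul ρ d12 d23, pd_mul ρ d22 d13] at hdet
  have z : ∀ μ : Fin 4, μ ≠ 0 → kerrInv M a χ x 0 μ = 0 ∧ kerrInv M a χ x μ 0 = 0 := by
    intro μ hμ
    fin_cases μ <;> simp [kerrInv] at hμ ⊢
  have h00 : kerrInv M a χ x 0 0 = 1 / qsq a (x 0) (x 1) := rfl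
  have h21 : kerrInv M a χ x 2 1 = kerrInv M a χ x 1 2 := rfl
  have h31 : kerrInv M a χ x 3 1 = kerrInv M a χ x 1 3 := rfl
  have h32 : kerrInv M a χ x 3 2 = kerrInv M a χ x 2 3 := rfl
  have g00 : pd ρ (fun y => kerrMetric M a χ y 0 0) x = pd ρ (fun y => qsq a (y 0) (y 1)) x := rfl
  simp only [metricTrace, Fin.sum_univ_four, gInv_kerr ha hx, (z 1 (by decide)).1,
    (z 1 (by decide)).2, (z 2 (by decide)).1, (z 2 (by decide)).2, (z 3 (by decide)).1,
    (z 3 (by decide)).2, h00, h21, h31, h32, hg.pd_symm ρ 2 1, hg.pd_symm ρ 3 1,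
    hg.pd_symm ρ 3 2, g00]
  obtain ⟨c1, c2, c3, c4, c5, c6⟩ := hcof
  simp only [← pow_two] at hdet
  generalize qsq a (x 0) (x 1) = q at *
  generalize Real.sin (x 0) ^ 2 = s at *
  rw [← sub_eq_iff_eq_add', eq_div_iff hqs]
  linear_combination -hdet - pd ρ (fun y => kerrMetric M a χ y 1 1) x * c1
    - 2 * pd ρ (fun y => kerrMetric M a χ y 1 2) x * c2
    - 2 * pd ρ (fun y => kerrMetric M a χ y 1 3) x * c3
    - pd ρ (fun y => kerrMetric M a χ y 2 2) x * c4
    - 2 * pd ρ (fun y => kerrMetric M a χ y 2 3) x * c5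
    - pd ρ (fun y => kerrMetric M a χ y 3 3) x * c6

lemma pd_kerrInv_theta (M a : ℝ) (χ : ℝ → ℝ) (x : Pt) (κ : Fin 4) (μ : Fin 4) (hμ : μ ≠ 0) :
    pd κ (fun y => kerrInv M a χ y 0 μ) x = 0 ∧ pd κ (fun y => kerrInv M a χ y μ 0) x = 0 := by
  fin_cases μ <;> simp [kerrInv, pd_const] at hμ ⊢

lemma pd_kerrInv_killing (M a : ℝ) (χ : ℝ → ℝ) (x : Pt) (μ ν : Fin 4) :
    pd 2 (fun y => kerrInv M a χ y μ ν) x = 0 ∧ pd 3 (fun y => kerrInv M a χ y μ ν) x = 0 :=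
  ⟨pd_eq_zero_of_update 2 fun y t => by simp [kerrInv, kerrW],
    pd_eq_zero_of_update 3 fun y t => by simp [kerrInv, kerrW]⟩

lemma hasDerivAt_qsq_theta (a θ r : ℝ) :
    HasDerivAt (fun t => qsq a t r) (-(2 * a ^ 2 * Real.cos θ * Real.sin θ)) θ := by
  have h := (((Real.hasDerivAt_cos θ).pow 2).const_mul (a ^ 2)).const_add (r ^ 2)
  refine h.congr_deriv ?_
  simp; ring

lemma hasDerivAt_qsq_r (a θ r : ℝ) : HasDerivAt (fun t => qsq a θ t) (2 * r) r := by
  have h := (hasDerivAt_pow 2 r).add_const (a ^ 2 * Real.cos θ ^ 2)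
  refine h.congr_deriv ?_
  simp

lemma hasDerivAt_Del (M a r : ℝ) : HasDerivAt (fun t => Del M a t) (2 * r - 2 * M) r := by
  have h := ((hasDerivAt_pow 2 r).add_const (a ^ 2)).sub ((hasDerivAt_id r).const_mul (2 * M))
  refine h.congr_deriv ?_
  simp

lemma pd_zero_qsq (a : ℝ) (x : Pt) : pd 0 (fun y => qsq a (y 0) (y 1)) x
    = -(2 * a ^ 2 * Real.cos (x 0) * Real.sin (x 0)) :=
  pd_zero_of_hasDerivAt (differentiableAt_qsq a x) (hasDerivAt_qsq_theta a _ _)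

lemma pd_one_qsq (a : ℝ) (x : Pt) : pd 1 (fun y => qsq a (y 0) (y 1)) x = 2 * x 1 :=
  pd_one_of_hasDerivAt (differentiableAt_qsq a x) (hasDerivAt_qsq_r a _ _)

lemma metricTrace_zero_kerr (ha : |a| ≤ M) (hχ : ContDiff ℝ ∞ χ) (hx : x ∈ kerrRegion M a χ) :
    metricTrace (kerrMetric M a χ) x 0
      = -(4 * a ^ 2 * Real.cos (x 0) * Real.sin (x 0)) / qsq a (x 0) (x 1)
        + 2 * Real.cos (x 0) / Real.sin (x 0) := by
  have hq := (qsq_pos hx).ne'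
  have hs := hx.2.1
  have ds : DifferentiableAt ℝ (fun y : Pt => Real.sin (y 0) ^ 2) x := by fun_prop
  have hs2 : pd 0 (fun y : Pt => Real.sin (y 0) ^ 2) x = 2 * Real.sin (x 0) * Real.cos (x 0) := by
    refine pd_zero_of_hasDerivAt (F := fun θ _ => Real.sin θ ^ 2) ds ?_
    refine ((Real.hasDerivAt_sin (x 0)).pow 2).congr_deriv ?_
    simp
  rw [metricTrace_kerr ha hχ hx, pd_mul 0 (differentiableAt_qsq a x) ds, hs2, pd_zero_qsq]
  field_simp
  ring

lemma metricTrace_one_kerr (ha : |a| ≤ M) (hχ : ContDiff ℝ ∞ χ) (hx : x ∈ kerrRegion M a χ) :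
    metricTrace (kerrMetric M a χ) x 1 = 4 * x 1 / qsq a (x 0) (x 1) := by
  have hq := (qsq_pos hx).ne'
  have hs := hx.2.1
  have ds : DifferentiableAt ℝ (fun y : Pt => Real.sin (y 0) ^ 2) x := by fun_prop
  have hs2 : pd 1 (fun y : Pt => Real.sin (y 0) ^ 2) x = 0 :=
    pd_one_of_hasDerivAt (F := fun θ _ => Real.sin θ ^ 2) ds (hasDerivAt_const _ _)
  rw [metricTrace_kerr ha hχ hx, pd_mul 1 (differentiableAt_qsq a x) ds, hs2, pd_one_qsq]
  field_simp
  ring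

lemma metricTrace_killing (x : Pt) : metricTrace (kerrMetric M a χ) x 2 = 0 ∧
    metricTrace (kerrMetric M a χ) x 3 = 0 := by
  simp [metricTrace, pd_two_kerrMetric, pd_three_kerrMetric]

/-- Only the $\theta$ and $r$ components of the trace are needed, since $\square$ will be applied to
functions of $(\theta,r)$. -/
lemma christoffelTrace_zero_kerr (ha : |a| ≤ M) (hχ : ContDiff ℝ ∞ χ)
    (hx : x ∈ kerrRegion M a χ) : christoffelTrace (kerrMetric M a χ) x 0
      = -(Real.cos (x 0) / Real.sin (x 0) / qsq a (x 0) (x 1)) := by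
  have hq := (qsq_pos hx).ne'
  have hs := hx.2.1
  have z1 : kerrInv M a χ x 0 1 = 0 := rfl
  have z0 : kerrInv M a χ x 0 0 = 1 / qsq a (x 0) (x 1) := rfl
  have d0 : pd 0 (fun y => kerrInv M a χ y 0 0) x
      = 2 * a ^ 2 * Real.cos (x 0) * Real.sin (x 0) / qsq a (x 0) (x 1) ^ 2 := by
    have : (fun y => kerrInv M a χ y 0 0) = fun y => (qsq a (y 0) (y 1))⁻¹ := by
      funext y; exact one_div _
    rw [this, pd_inv 0 (differentiableAt_qsq a x) hq, pd_zero_qsq]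
    field_simp
  rw [(regularAt_kerr ha hχ hx).christoffelTrace_eq]
  simp only [pd_gInv_kerr ha hx, gInv_kerr ha hx, Fin.sum_univ_four, metricTrace_killing x,
    (pd_kerrInv_killing M a χ x 0 _).1, (pd_kerrInv_killing M a χ x 0 _).2, z1, z0, d0,
    (pd_kerrInv_theta M a χ x 1 1 (by decide)).1, metricTrace_zero_kerr ha hχ hx]
  field_simp
  ring

lemma christoffelTrace_one_kerr (ha : |a| ≤ M) (hχ : ContDiff ℝ ∞ χ)
    (hx : x ∈ kerrRegion M a χ) : christoffelTrace (kerrMetric M a χ) x 1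
      = -((2 * x 1 - 2 * M) / qsq a (x 0) (x 1)) := by
  have hq := (qsq_pos hx).ne'
  have z1 : kerrInv M a χ x 1 0 = 0 := rfl
  have z0 : kerrInv M a χ x 1 1 = Del M a (x 1) / qsq a (x 0) (x 1) := rfl
  have hD : pd 1 (fun y : Pt => Del M a (y 1)) x = 2 * x 1 - 2 * M :=
    pd_one_of_hasDerivAt (F := fun _ r => Del M a r) (differentiableAt_Del M a x)
      (hasDerivAt_Del M a _)
  have d0 : pd 1 (fun y => kerrInv M a χ y 1 1) x
      = (2 * x 1 - 2 * M) / qsq a (x 0) (x 1)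
        - Del M a (x 1) * (2 * x 1) / qsq a (x 0) (x 1) ^ 2 := by
    have : (fun y => kerrInv M a χ y 1 1)
        = fun y => Del M a (y 1) * (qsq a (y 0) (y 1))⁻¹ := by
      funext y; exact div_eq_mul_inv _ _
    have di : DifferentiableAt ℝ (fun y : Pt => (qsq a (y 0) (y 1))⁻¹) x :=
      (differentiableAt_qsq a x).fun_inv hq
    rw [this, pd_mul 1 (differentiableAt_Del M a x) di,
      pd_inv 1 (differentiableAt_qsq a x) hq, pd_one_qsq, hD]
    field_simp
    ring
  rw [(regularAt_kerr ha hχ hx).christoffelTrace_eq]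
  simp only [pd_gInv_kerr ha hx, gInv_kerr ha hx, Fin.sum_univ_four, metricTrace_killing x,
    (pd_kerrInv_killing M a χ x 1 _).1, (pd_kerrInv_killing M a χ x 1 _).2, z1, z0, d0,
    (pd_kerrInv_theta M a χ x 0 1 (by decide)).2, metricTrace_one_kerr ha hχ hx]
  field_simp
  ring

end kerr

/-! ### The Ernst equations -/

/-- The first and second partial derivatives, for `r > 0`, of a function of `(c, r)`. -/
structure HasPartials (K Kc Kr Kcc Krr : ℝ → ℝ → ℝ) : Prop where
  dc : ∀ c r, 0 < r → HasDerivAt (fun t => K t r) (Kc c r) c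
  dr : ∀ c r, 0 < r → HasDerivAt (fun t => K c t) (Kr c r) r
  dcc : ∀ c r, 0 < r → HasDerivAt (fun t => Kc t r) (Kcc c r) c
  drr : ∀ c r, 0 < r → HasDerivAt (fun t => Kr c t) (Krr c r) r

section

variable {M a : ℝ} {χ : ℝ → ℝ} {x : Pt} {K Kc Kr Kcc Krr : ℝ → ℝ → ℝ}

lemma HasPartials.pd_zero (hK : HasPartials K Kc Kr Kcc Krr)
    (hd : DifferentiableAt ℝ (fun y : Pt => K (Real.cos (y 0)) (y 1)) x) (hx : 0 < x 1) :
    pd 0 (fun y => K (Real.cos (y 0)) (y 1)) x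
      = -Real.sin (x 0) * Kc (Real.cos (x 0)) (x 1) := by
  refine pd_zero_of_hasDerivAt (F := fun θ r => K (Real.cos θ) r) hd ?_
  have h := (hK.dc (Real.cos (x 0)) (x 1) hx).comp (x 0) (Real.hasDerivAt_cos (x 0))
  exact h.congr_deriv (by ring)

lemma HasPartials.pd_one (hK : HasPartials K Kc Kr Kcc Krr)
    (hd : DifferentiableAt ℝ (fun y : Pt => K (Real.cos (y 0)) (y 1)) x) (hx : 0 < x 1) :
    pd 1 (fun y => K (Real.cos (y 0)) (y 1)) x = Kr (Real.cos (x 0)) (x 1) :=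
  pd_one_of_hasDerivAt (F := fun θ r => K (Real.cos θ) r) hd (hK.dr _ _ hx)

lemma eventually_r_pos (hx : 0 < x 1) : ∀ᶠ y : Pt in 𝓝 x, 0 < y 1 :=
  (continuous_apply 1).continuousAt.eventually (lt_mem_nhds hx)

/-- The wave operator on functions of `(cos θ, r)`. -/
lemma HasPartials.box_kerr (hK : HasPartials K Kc Kr Kcc Krr)
    (hd : ∀ y : Pt, 0 < y 1 → ContDiffAt ℝ 2 (fun y : Pt => K (Real.cos (y 0)) (y 1)) y)
    (ha : |a| ≤ M) (hχ : ContDiff ℝ ∞ χ) (hx : x ∈ kerrRegion M a χ) :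
    box (kerrMetric M a χ) (fun y => K (Real.cos (y 0)) (y 1)) x
      = ((1 - Real.cos (x 0) ^ 2) * Kcc (Real.cos (x 0)) (x 1)
          - 2 * Real.cos (x 0) * Kc (Real.cos (x 0)) (x 1)
          + Del M a (x 1) * Krr (Real.cos (x 0)) (x 1)
          + (2 * x 1 - 2 * M) * Kr (Real.cos (x 0)) (x 1)) / qsq a (x 0) (x 1) := by
  have hq := (qsq_pos hx).ne'
  have hs := hx.2.1
  have hr := hx.1
  set f : Pt → ℝ := fun y => K (Real.cos (y 0)) (y 1) with hf
  have hfd : ∀ y : Pt, 0 < y 1 → DifferentiableAt ℝ f y := fun y hy =>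
    (hd y hy).differentiableAt (by norm_num)
  have e0 : ∀ᶠ y in 𝓝 x, pd 0 f y = -Real.sin (y 0) * Kc (Real.cos (y 0)) (y 1) := by
    filter_upwards [eventually_r_pos hr] with y hy using hK.pd_zero (hfd y hy) hy
  have e1 : ∀ᶠ y in 𝓝 x, pd 1 f y = Kr (Real.cos (y 0)) (y 1) := by
    filter_upwards [eventually_r_pos hr] with y hy using hK.pd_one (hfd y hy) hy
  have d0 := (differentiableAt_pd 0 (hd x hr)).congr_of_eventuallyEq (e0.mono fun _ h => h.symm)
  have d1 := (differentiableAt_pd 1 (hd x hr)).congr_of_eventuallyEq (e1.mono fun _ h => h.symm)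
  have h00 : pd 0 (fun y => pd 0 f y) x = Real.sin (x 0) ^ 2 * Kcc (Real.cos (x 0)) (x 1)
      - Real.cos (x 0) * Kc (Real.cos (x 0)) (x 1) := by
    rw [pd_congr 0 e0]
    refine pd_zero_of_hasDerivAt (F := fun θ r => -Real.sin θ * Kc (Real.cos θ) r) d0 ?_
    have h := (hK.dcc (Real.cos (x 0)) (x 1) hr).comp (x 0) (Real.hasDerivAt_cos (x 0))
    exact ((Real.hasDerivAt_sin (x 0)).neg.mul h).congr_deriv (by simp; ring)
  have h11 : pd 1 (fun y => pd 1 f y) x = Krr (Real.cos (x 0)) (x 1) := by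
    rw [pd_congr 1 e1]
    exact pd_one_of_hasDerivAt (F := fun θ r => Kr (Real.cos θ) r) d1 (hK.drr _ _ hr)
  have f2 : ∀ y, pd 2 f y = 0 := pd_two_eq_zero fun θ r => K (Real.cos θ) r
  have f3 : ∀ y, pd 3 f y = 0 := pd_three_eq_zero fun θ r => K (Real.cos θ) r
  -- Second derivatives commute, so every one involving $t_+$ or $\phi_+$ contains a vanishing first
  -- derivative.
  have f22 : ∀ ν, pd 2 (fun y => pd ν f y) x = 0 := fun ν => by
    rw [pd_comm (hd x hr)]; simp only [f2, pd_const]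
  have f33 : ∀ ν, pd 3 (fun y => pd ν f y) x = 0 := fun ν => by
    rw [pd_comm (hd x hr)]; simp only [f3, pd_const]
  have z00 : kerrInv M a χ x 0 0 = 1 / qsq a (x 0) (x 1) := rfl
  have z11 : kerrInv M a χ x 1 1 = Del M a (x 1) / qsq a (x 0) (x 1) := rfl
  have z01 : kerrInv M a χ x 0 1 = 0 := rfl
  have z10 : kerrInv M a χ x 1 0 = 0 := rfl
  rw [box_eq]
  simp only [Fin.sum_univ_four, gInv_kerr ha hx, f22, f33, h00, h11, f2, f3, pd_const, z00, z11,
    z01, z10, christoffelTrace_zero_kerr ha hχ hx, christoffelTrace_one_kerr ha hχ hx,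
    e0.self_of_nhds, e1.self_of_nhds, Real.sin_sq]
  field_simp
  ring

/-- The scalar product of differentials of functions of `(θ, r)`. -/
lemma dot_kerr_of_axisymmetric (ha : |a| ≤ M) (hx : x ∈ kerrRegion M a χ) {m η : Covec}
    (hm : m 2 = 0 ∧ m 3 = 0) (hη : η 2 = 0 ∧ η 3 = 0) :
    dot (kerrMetric M a χ) x m η
      = (m 0 * η 0 + Del M a (x 1) * m 1 * η 1) / qsq a (x 0) (x 1) := by
  have z00 : kerrInv M a χ x 0 0 = 1 / qsq a (x 0) (x 1) := rfl
  have z11 : kerrInv M a χ x 1 1 = Del M a (x 1) / qsq a (x 0) (x 1) := rfl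
  have z01 : kerrInv M a χ x 0 1 = 0 := rfl
  have z10 : kerrInv M a χ x 1 0 = 0 := rfl
  simp only [dot, gInv_kerr ha hx, Fin.sum_univ_four, hm.1, hm.2, hη.1, hη.2, z00, z11, z01, z10]
  ring

end

/-! The Ernst potential in the coordinates `(c, r)`, where `c = cos θ`, with its derivatives. -/

/-- The function `1 / q²`. -/
def qInv (a c r : ℝ) : ℝ := (r ^ 2 + a ^ 2 * c ^ 2)⁻¹

/-- Expanding $\Sigma^2$ confines $1/q^2$ to one summand; all derivatives are then polynomials in
$c$, $r$ and `qInv`. -/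
def potA (M a c r : ℝ) : ℝ :=
  (1 - c ^ 2) * (r ^ 2 + a ^ 2) + 2 * M * a ^ 2 * r * (1 - c ^ 2) ^ 2 * qInv a c r

def potAc (M a c r : ℝ) : ℝ :=
  -2 * c * (r ^ 2 + a ^ 2) + 2 * M * a ^ 2 * r * (-4 * c * (1 - c ^ 2) * qInv a c r
    - 2 * a ^ 2 * c * (1 - c ^ 2) ^ 2 * qInv a c r ^ 2)

def potAr (M a c r : ℝ) : ℝ :=
  2 * r * (1 - c ^ 2)
    + 2 * M * a ^ 2 * (1 - c ^ 2) ^ 2 * (qInv a c r - 2 * r ^ 2 * qInv a c r ^ 2)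

def potAcc (M a c r : ℝ) : ℝ :=
  -2 * (r ^ 2 + a ^ 2)
    + 2 * M * a ^ 2 * r * ((-4 + 12 * c ^ 2) * qInv a c r
      + 8 * a ^ 2 * c ^ 2 * (1 - c ^ 2) * qInv a c r ^ 2
      - 2 * a ^ 2 * ((1 - c ^ 2) ^ 2 - 4 * c ^ 2 * (1 - c ^ 2)) * qInv a c r ^ 2
      + 8 * a ^ 4 * c ^ 2 * (1 - c ^ 2) ^ 2 * qInv a c r ^ 3)

def potArr (M a c r : ℝ) : ℝ :=
  2 * (1 - c ^ 2) + 2 * M * a ^ 2 * (1 - c ^ 2) ^ 2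
    * (-6 * r * qInv a c r ^ 2 + 8 * r ^ 3 * qInv a c r ^ 3)

def potB (M a c r : ℝ) : ℝ :=
  -2 * a * M * (3 * c - c ^ 3 + a ^ 2 * c * (1 - c ^ 2) ^ 2 * qInv a c r)

def potBc (M a c r : ℝ) : ℝ :=
  -2 * a * M * (3 - 3 * c ^ 2 + a ^ 2 * (1 - 6 * c ^ 2 + 5 * c ^ 4) * qInv a c r
    - 2 * a ^ 4 * c ^ 2 * (1 - c ^ 2) ^ 2 * qInv a c r ^ 2)

def potBr (M a c r : ℝ) : ℝ :=
  4 * a ^ 3 * M * c * r * (1 - c ^ 2) ^ 2 * qInv a c r ^ 2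

def potBcc (M a c r : ℝ) : ℝ :=
  -2 * a * M * (-6 * c + a ^ 2 * (-12 * c + 20 * c ^ 3) * qInv a c r
    - 2 * a ^ 4 * c * (1 - 6 * c ^ 2 + 5 * c ^ 4) * qInv a c r ^ 2
    - 2 * a ^ 4 * (2 * c * (1 - c ^ 2) ^ 2 - 4 * c ^ 3 * (1 - c ^ 2)) * qInv a c r ^ 2
    + 8 * a ^ 6 * c ^ 3 * (1 - c ^ 2) ^ 2 * qInv a c r ^ 3)

def potBrr (M a c r : ℝ) : ℝ :=
  4 * a ^ 3 * M * c * (1 - c ^ 2) ^ 2 * (qInv a c r ^ 2 - 4 * r ^ 2 * qInv a c r ^ 3)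

section

variable (M a : ℝ)

lemma qc_pos (c : ℝ) {r : ℝ} (hr : 0 < r) : 0 < r ^ 2 + a ^ 2 * c ^ 2 := by positivity

lemma hasDerivAt_qInv_c (c : ℝ) {r : ℝ} (hr : 0 < r) :
    HasDerivAt (fun t => qInv a t r) (-(2 * a ^ 2 * c) * qInv a c r ^ 2) c := by
  have h := (((hasDerivAt_pow 2 c).const_mul (a ^ 2)).const_add (r ^ 2)).inv (qc_pos a c hr).ne'
  refine h.congr_deriv ?_
  simp [qInv]; ring

lemma hasDerivAt_qInv_r (c : ℝ) {r : ℝ} (hr : 0 < r) :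
    HasDerivAt (fun t => qInv a c t) (-(2 * r) * qInv a c r ^ 2) r := by
  have h := ((hasDerivAt_pow 2 r).add_const (a ^ 2 * c ^ 2)).inv (qc_pos a c hr).ne'
  refine h.congr_deriv ?_
  simp [qInv]; ring

lemma hasPartials_potA : HasPartials (potA M a) (potAc M a) (potAr M a) (potAcc M a)
    (potArr M a) where
  dc c r hr := by
    have hp := hasDerivAt_qInv_c a c hr
    have hi := hasDerivAt_id' c
    have h1 := (hi.pow 2).const_sub 1
    refine (((h1.mul_const (r ^ 2 + a ^ 2)).add
      (((h1.pow 2).const_mul (2 * M * a ^ 2 * r)).mul hp))).congr_deriv ?_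
    simp [potAc, -mul_eq_mul_left_iff]; ring
  dr c r hr := by
    have hp := hasDerivAt_qInv_r a c hr
    have hi := hasDerivAt_id' r
    refine (((hi.pow 2).add_const (a ^ 2)).const_mul (1 - c ^ 2)).add
      (((hi.const_mul (2 * M * a ^ 2)).mul_const ((1 - c ^ 2) ^ 2)).mul hp) |>.congr_deriv ?_
    simp [potAr, -mul_eq_mul_left_iff]; ring
  dcc c r hr := by
    have hp := hasDerivAt_qInv_c a c hr
    have hi := hasDerivAt_id' c
    have h1 := (hi.pow 2).const_sub 1
    refine ((hi.const_mul (-2)).mul_const (r ^ 2 + a ^ 2)).add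
      (((((hi.const_mul (-4)).mul h1).mul hp).sub
        (((hi.const_mul (2 * a ^ 2)).mul (h1.pow 2)).mul (hp.pow 2))).const_mul
          (2 * M * a ^ 2 * r)) |>.congr_deriv ?_
    simp [potAcc, -mul_eq_mul_left_iff]; ring
  drr c r hr := by
    have hp := hasDerivAt_qInv_r a c hr
    have hi := hasDerivAt_id' r
    refine ((hi.const_mul 2).mul_const (1 - c ^ 2)).add
      ((hp.sub (((hi.pow 2).const_mul 2).mul (hp.pow 2))).const_mul
        (2 * M * a ^ 2 * (1 - c ^ 2) ^ 2)) |>.congr_deriv ?_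
    simp [potArr, -mul_eq_mul_left_iff]; ring

lemma hasPartials_potB : HasPartials (potB M a) (potBc M a) (potBr M a) (potBcc M a)
    (potBrr M a) where
  dc c r hr := by
    have hp := hasDerivAt_qInv_c a c hr
    have hi := hasDerivAt_id' c
    have h1 := (hi.pow 2).const_sub 1
    refine ((((hi.const_mul 3).sub (hi.pow 3)).add
      (((hi.const_mul (a ^ 2)).mul (h1.pow 2)).mul hp)).const_mul (-2 * a * M)).congr_deriv ?_
    simp [potBc, -mul_eq_mul_left_iff]; ring
  dr c r hr := by
    have hp := hasDerivAt_qInv_r a c hr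
    refine (((hp.const_mul (a ^ 2 * c * (1 - c ^ 2) ^ 2)).const_add (3 * c - c ^ 3)).const_mul
      (-2 * a * M)).congr_deriv ?_
    simp [potBr, -mul_eq_mul_left_iff]; ring
  dcc c r hr := by
    have hp := hasDerivAt_qInv_c a c hr
    have hi := hasDerivAt_id' c
    have h1 := (hi.pow 2).const_sub 1
    have h3 := (((hi.pow 2).const_mul 3).const_sub 3)
    have h6 := ((((hi.pow 2).const_mul 6).const_sub 1).add ((hi.pow 4).const_mul 5)).const_mul
      (a ^ 2)
    refine ((h3.add (h6.mul hp)).sub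
      ((((hi.pow 2).const_mul (2 * a ^ 4)).mul (h1.pow 2)).mul (hp.pow 2))).const_mul
        (-2 * a * M) |>.congr_deriv ?_
    simp [potBcc, -mul_eq_mul_left_iff]; ring
  drr c r hr := by
    have hp := hasDerivAt_qInv_r a c hr
    have hi := hasDerivAt_id' r
    refine ((hi.const_mul (4 * a ^ 3 * M * c)).mul_const ((1 - c ^ 2) ^ 2)).mul
      (hp.pow 2) |>.congr_deriv ?_
    simp [potBrr, -mul_eq_mul_left_iff]; ring

lemma contDiffAt_pot {y : Pt} (hy : 0 < y 1) :
    ContDiffAt ℝ 2 (fun y : Pt => potA M a (Real.cos (y 0)) (y 1)) y ∧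
    ContDiffAt ℝ 2 (fun y : Pt => potB M a (Real.cos (y 0)) (y 1)) y := by
  have h := (qc_pos a (Real.cos (y 0)) hy).ne'
  constructor
  · unfold potA qInv; fun_prop (disch := assumption)
  · unfold potB qInv; fun_prop (disch := assumption)

variable {M a}

/-- The bracket is $q^2\square$ written in $c=\cos\theta$, so this is $A\square A=|dA|^2-|dB|^2$
times $q^2$. In $(c,r)$ everything is rational, and clearing denominators leaves a polynomial
identity. -/
lemma potA_ernst (c : ℝ) {r : ℝ} (hr : 0 < r) :
    potA M a c r * ((1 - c ^ 2) * potAcc M a c r - 2 * c * potAc M a c r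
      + Del M a r * potArr M a c r + (2 * r - 2 * M) * potAr M a c r)
    = (1 - c ^ 2) * (potAc M a c r ^ 2 - potBc M a c r ^ 2)
      + Del M a r * (potAr M a c r ^ 2 - potBr M a c r ^ 2) := by
  have h := (qc_pos a c hr).ne'
  simp only [potA, potAc, potAr, potAcc, potArr, potBc, potBr, Del, qInv]
  field_simp
  ring

lemma potB_ernst (c : ℝ) {r : ℝ} (hr : 0 < r) :
    potA M a c r * ((1 - c ^ 2) * potBcc M a c r - 2 * c * potBc M a c r
      + Del M a r * potBrr M a c r + (2 * r - 2 * M) * potBr M a c r)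
    = 2 * ((1 - c ^ 2) * (potAc M a c r * potBc M a c r)
      + Del M a r * (potAr M a c r * potBr M a c r)) := by
  have h := (qc_pos a c hr).ne'
  simp only [potA, potAc, potAr, potBcc, potBrr, potBc, potBr, Del, qInv]
  field_simp
  ring

end

lemma dot_neg_left (g : MetricField) (x : Pt) (m η : Covec) : dot g x (-m) η = -dot g x m η := by
  rw [← neg_one_smul ℝ m, dot_smul_left]; ring

lemma dform_mul {f h : Pt → ℝ} {x : Pt} (hf : DifferentiableAt ℝ f x)
    (hh : DifferentiableAt ℝ h x) :
    dform (fun y => f y * h y) x = h x • dform f x + f x • dform h x := by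
  funext μ
  simp only [dform, pd_mul μ hf hh, Pi.add_apply, Pi.smul_apply, smul_eq_mul]
  ring

lemma dform_mul_inv {f h : Pt → ℝ} {x : Pt} (hf : DifferentiableAt ℝ f x)
    (hh : DifferentiableAt ℝ h x) (h0 : h x ≠ 0) :
    dform (fun y => f y * (h y)⁻¹) x
      = (h x)⁻¹ • dform f x - (f x * (h x)⁻¹ ^ 2) • dform h x := by
  funext μ
  simp only [dform, pd_mul μ hf (hh.fun_inv h0), pd_inv μ hh h0, Pi.sub_apply, Pi.smul_apply,
    smul_eq_mul]
  ring

lemma dform_congr {f h : Pt → ℝ} {x : Pt} (e : f =ᶠ[𝓝 x] h) : dform f x = dform h x :=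
  funext fun μ => pd_congr μ e

lemma box_congr (g : MetricField) {f h : Pt → ℝ} {x : Pt} (e : f =ᶠ[𝓝 x] h) :
    box g f x = box g h x := by
  have e' : ∀ ν, (fun y => dform f y ν) =ᶠ[𝓝 x] fun y => dform h y ν := fun ν =>
    e.eventuallyEq_nhds.mono fun y hy => congrFun (dform_congr hy) ν
  simp only [box, divForm, covForm, pd_congr _ (e' _), dform_congr e]

section ernst

variable {M a : ℝ} {χ : ℝ → ℝ} {x : Pt}

lemma ernstB_eq (M a : ℝ) :
    ernstB M a = fun y => potB M a (Real.cos (y 0)) (y 1) := by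
  funext y
  have : Real.sin (y 0) ^ 4 = (1 - Real.cos (y 0) ^ 2) ^ 2 := by
    rw [← Real.sin_sq]; ring
  simp only [ernstB, potB, qInv, qsq, this]
  ring

/-- Equality is only claimed near points with $r>0$: where $q^2=0$, division by zero makes `ernstA`
vanish while `potA` need not. -/
lemma ernstA_eventuallyEq (hx : 0 < x 1) :
    ernstA M a =ᶠ[𝓝 x] fun y => potA M a (Real.cos (y 0)) (y 1) := by
  filter_upwards [eventually_r_pos hx] with y hy
  have h := (qc_pos a (Real.cos (y 0)) hy).ne'
  simp only [ernstA, potA, qInv, Sigsq, qsq, Real.sin_sq]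
  field_simp

lemma contDiffAt_ernstA (hx : 0 < x 1) : ContDiffAt ℝ 2 (ernstA M a) x :=
  (contDiffAt_pot M a hx).1.congr_of_eventuallyEq (ernstA_eventuallyEq hx)

lemma contDiffAt_ernstB (hx : 0 < x 1) : ContDiffAt ℝ 2 (ernstB M a) x := by
  rw [ernstB_eq]; exact (contDiffAt_pot M a hx).2

lemma dform_ernst_killing (M a : ℝ) (x : Pt) :
    (dform (ernstA M a) x 2 = 0 ∧ dform (ernstA M a) x 3 = 0) ∧
    dform (ernstB M a) x 2 = 0 ∧ dform (ernstB M a) x 3 = 0 :=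
  ⟨⟨pd_eq_zero_of_update 2 fun y t => by simp [ernstA],
    pd_eq_zero_of_update 3 fun y t => by simp [ernstA]⟩,
    pd_eq_zero_of_update 2 fun y t => by simp [ernstB],
    pd_eq_zero_of_update 3 fun y t => by simp [ernstB]⟩

/-- The Ernst equations for the Ernst potential of `Z`. -/
lemma ernst_equations (ha : |a| ≤ M) (hχ : ContDiff ℝ ∞ χ) (hx : x ∈ kerrRegion M a χ) :
    ernstA M a x * box (kerrMetric M a χ) (ernstA M a) x
      = dot (kerrMetric M a χ) x (dform (ernstA M a) x) (dform (ernstA M a) x)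
        - dot (kerrMetric M a χ) x (dform (ernstB M a) x) (dform (ernstB M a) x) ∧
    ernstA M a x * box (kerrMetric M a χ) (ernstB M a) x
      = 2 * dot (kerrMetric M a χ) x (dform (ernstA M a) x) (dform (ernstB M a) x) := by
  have hr := hx.1
  have hq := (qsq_pos hx).ne'
  have eA := ernstA_eventuallyEq (M := M) (a := a) hr
  have dA := (contDiffAt_pot M a hr).1.differentiableAt (by norm_num)
  have dB := (contDiffAt_pot M a hr).2.differentiableAt (by norm_num)
  obtain ⟨kA, kB⟩ := dform_ernst_killing M a x
  rw [dot_kerr_of_axisymmetric ha hx kA kA, dot_kerr_of_axisymmetric ha hx kB kB,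
    dot_kerr_of_axisymmetric ha hx kA kB, box_congr _ eA, dform_congr eA, eA.self_of_nhds,
    ernstB_eq, (hasPartials_potA M a).box_kerr (fun y hy => (contDiffAt_pot M a hy).1) ha hχ hx,
    (hasPartials_potB M a).box_kerr (fun y hy => (contDiffAt_pot M a hy).2) ha hχ hx]
  simp only [dform, (hasPartials_potA M a).pd_zero dA hr, (hasPartials_potA M a).pd_one dA hr,
    (hasPartials_potB M a).pd_zero dB hr, (hasPartials_potB M a).pd_one dB hr]
  have e1 := potA_ernst (M := M) (a := a) (Real.cos (x 0)) hr
  have e2 := potB_ernst (M := M) (a := a) (Real.cos (x 0)) hr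
  rw [← Real.sin_sq] at e1 e2 ⊢
  constructor
  · rw [← mul_div_assoc, e1]; field_simp; ring
  · rw [← mul_div_assoc, e2]; field_simp

end ernst

/-! ### The energy-momentum tensor of the linearized system -/

section system

variable {M a : ℝ} {χ : ℝ → ℝ} {x : Pt} {φ ψ : Pt → ℝ}

lemma formE_eq (M a : ℝ) (φ ψ : Pt → ℝ) : formE M a φ ψ
    = fun y => dform φ y + (ψ y * (ernstA M a y)⁻¹) • dform (ernstB M a) y := rfl

lemma formF_eq (M a : ℝ) (φ ψ : Pt → ℝ) : formF M a φ ψ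
    = fun y => dform ψ y - (φ y * (ernstA M a y)⁻¹) • dform (ernstB M a) y := rfl

lemma formM_eq (M a : ℝ) (φ ψ : Pt → ℝ) : formM M a φ ψ
    = fun y => (φ y * (ernstA M a y)⁻¹) • dform (ernstB M a) y
      - (ψ y * (ernstA M a y)⁻¹) • dform (ernstA M a) y := by
  funext y μ
  simp only [formM, dform, Pi.sub_apply, Pi.smul_apply, smul_eq_mul, div_eq_mul_inv]
  ring

/-- The Lagrangian is a sum over the three one-forms, so each of them takes its own trace term. -/
lemma emTensor_eq (M a : ℝ) (χ : ℝ → ℝ) (φ ψ : Pt → ℝ) : emTensor M a χ φ ψ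
    = fun y => formStress (kerrMetric M a χ) (formE M a φ ψ) y
      + formStress (kerrMetric M a χ) (formF M a φ ψ) y
      + formStress (kerrMetric M a χ) (formM M a φ ψ) y := by
  funext y μ ν
  simp only [emTensor, lagr, formStress, Pi.add_apply]
  ring

lemma emTensor_symm (y : Pt) (μ ν : Fin 4) :
    emTensor M a χ φ ψ y μ ν = emTensor M a χ φ ψ y ν μ := by
  simp only [emTensor, kerrMetric_symm M a χ y μ ν]; ring

lemma differentiableAt_dform {f : Pt → ℝ} (hf : ContDiffAt ℝ 2 f x) (μ : Fin 4) :
    DifferentiableAt ℝ (fun y => dform f y μ) x := differentiableAt_pd μ hf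

lemma differentiableAt_mul_inv_ernstA (hM : 0 < M) (hx : x ∈ kerrRegion M a χ) {f : Pt → ℝ}
    (hf : ContDiffAt ℝ 2 f x) : DifferentiableAt ℝ (fun y => f y * (ernstA M a y)⁻¹) x :=
  (hf.differentiableAt (by norm_num)).fun_mul
    (((contDiffAt_ernstA hx.1).differentiableAt (by norm_num)).fun_inv (ernstA_pos hM hx).ne')

lemma differentiableAt_smul_dform {f h : Pt → ℝ} (hf : DifferentiableAt ℝ f x)
    (hh : ContDiffAt ℝ 2 h x) (μ : Fin 4) :
    DifferentiableAt ℝ (fun y => (f y • dform h y) μ) x :=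
  hf.fun_mul (differentiableAt_dform hh μ)

lemma differentiableAt_forms (hM : 0 < M) (hx : x ∈ kerrRegion M a χ)
    (hφ : ContDiffAt ℝ 2 φ x) (hψ : ContDiffAt ℝ 2 ψ x) (μ : Fin 4) :
    DifferentiableAt ℝ (fun y => formE M a φ ψ y μ) x ∧
    DifferentiableAt ℝ (fun y => formF M a φ ψ y μ) x ∧
    DifferentiableAt ℝ (fun y => formM M a φ ψ y μ) x := by
  have hB := contDiffAt_ernstB (M := M) (a := a) hx.1
  have hA := contDiffAt_ernstA (M := M) (a := a) hx.1
  have dα := differentiableAt_mul_inv_ernstA hM hx hψ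
  have dβ := differentiableAt_mul_inv_ernstA hM hx hφ
  rw [formE_eq, formF_eq, formM_eq]
  exact ⟨(differentiableAt_dform hφ μ).fun_add (differentiableAt_smul_dform dα hB μ),
    (differentiableAt_dform hψ μ).fun_sub (differentiableAt_smul_dform dβ hB μ),
    (differentiableAt_smul_dform dβ hB μ).fun_sub (differentiableAt_smul_dform dα hA μ)⟩

lemma differentiableAt_emTensor (hM : 0 < M) (ha : |a| ≤ M) (hχ : ContDiff ℝ ∞ χ)
    (hx : x ∈ kerrRegion M a χ) (hφ : ContDiffAt ℝ 2 φ x) (hψ : ContDiffAt ℝ 2 ψ x)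
    (μ ν : Fin 4) : DifferentiableAt ℝ (fun y => emTensor M a χ φ ψ y μ ν) x := by
  have hg := regularAt_kerr ha hχ hx
  have hd := differentiableAt_forms hM hx hφ hψ
  rw [emTensor_eq]
  exact ((hg.differentiableAt_formStress (fun μ => (hd μ).1) μ ν).fun_add
    (hg.differentiableAt_formStress (fun μ => (hd μ).2.1) μ ν)).fun_add
    (hg.differentiableAt_formStress (fun μ => (hd μ).2.2) μ ν)

variable {Nφ Nψ : Pt → ℝ}

/-- The wave operators of a solution, and of the Ernst potential, in terms of `A⁻¹`. -/
lemma boxes_of_solves (hM : 0 < M) (ha : |a| ≤ M) (hχ : ContDiff ℝ ∞ χ)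
    (hx : x ∈ kerrRegion M a χ) {U : Set Pt} (hxU : x ∈ U)
    (hs : SolvesLinearized M a χ U φ ψ Nφ Nψ) :
    let g := kerrMetric M a χ
    let i := (ernstA M a x)⁻¹
    let dA := dform (ernstA M a) x
    let dB := dform (ernstB M a) x
    box g φ x = Nφ x - 2 * i * dot g x dB (dform ψ x) + 2 * i ^ 2 * dot g x dB dB * φ x
      - 2 * i ^ 2 * dot g x dA dB * ψ x ∧
    box g ψ x = Nψ x + 2 * i * dot g x dB (dform φ x)
      + i ^ 2 * (dot g x dA dA + dot g x dB dB) * ψ x ∧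
    box g (ernstA M a) x = i * (dot g x dA dA - dot g x dB dB) ∧
    box g (ernstB M a) x = 2 * i * dot g x dA dB := by
  intro g i dA dB
  have hA := (ernstA_pos hM hx).ne'
  obtain ⟨e1, e2⟩ := ernst_equations ha hχ hx
  obtain ⟨f1, f2⟩ := hs x hxU
  have hc := (regularAt_kerr ha hχ hx).dot_comm dB dA
  simp only [div_eq_mul_inv, ← inv_pow] at f1 f2
  refine ⟨?_, ?_, ?_, ?_⟩
  · rw [← f1, ← hc]; ring
  · rw [← f2]; ring
  · rw [← e1, inv_mul_cancel_left₀ hA]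
  · rw [mul_comm 2 i, mul_assoc, ← e2, inv_mul_cancel_left₀ hA]

/-- The divergence of the energy-momentum tensor. -/
lemma divTensor_emTensor (hM : 0 < M) (ha : |a| ≤ M) (hχ : ContDiff ℝ ∞ χ)
    (hx : x ∈ kerrRegion M a χ) {U : Set Pt} (hxU : x ∈ U) (hφ : ContDiffAt ℝ 2 φ x)
    (hψ : ContDiffAt ℝ 2 ψ x) (hs : SolvesLinearized M a χ U φ ψ Nφ Nψ) (ν : Fin 4) :
    divTensor (kerrMetric M a χ) (emTensor M a χ φ ψ) x ν = source M a χ φ ψ Nφ Nψ x ν := by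
  have hg := regularAt_kerr ha hχ hx
  have hd := differentiableAt_forms hM hx hφ hψ
  have hA0 := (ernstA_pos hM hx).ne'
  have hA := contDiffAt_ernstA (M := M) (a := a) hx.1
  have hB := contDiffAt_ernstB (M := M) (a := a) hx.1
  have dα := differentiableAt_mul_inv_ernstA hM hx hψ
  have dβ := differentiableAt_mul_inv_ernstA hM hx hφ
  have eα := dform_mul_inv (hψ.differentiableAt (by norm_num)) (hA.differentiableAt (by norm_num))
    hA0
  have eβ := dform_mul_inv (hφ.differentiableAt (by norm_num)) (hA.differentiableAt (by norm_num))
    hA0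
  have sS := fun (Y : Pt → Covec) hY => hg.differentiableAt_formStress (Y := Y) hY
  obtain ⟨b1, b2, b3, b4⟩ := boxes_of_solves hM ha hχ hx hxU hs
  have kφ := differentiableAt_dform hφ
  have kψ := differentiableAt_dform hψ
  have kαB := differentiableAt_smul_dform dα hB
  have kβB := differentiableAt_smul_dform dβ hB
  have kαA := differentiableAt_smul_dform dα hA
  have key : ∀ Y : Pt → Covec, (∀ μ, DifferentiableAt ℝ (fun y => Y y μ) x) → _ :=
    fun Y hY => hg.divTensor_formStress hY ν
  have split := divTensor_add (g := kerrMetric M a χ) (x := x)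
    (S := fun y => formStress (kerrMetric M a χ) (formE M a φ ψ) y
      + formStress (kerrMetric M a χ) (formF M a φ ψ) y)
    (S' := formStress (kerrMetric M a χ) (formM M a φ ψ))
    (fun μ ν => (sS _ (fun μ => (hd μ).1) μ ν).fun_add (sS _ (fun μ => (hd μ).2.1) μ ν))
    (sS _ fun μ => (hd μ).2.2) ν
  rw [emTensor_eq, split, divTensor_add (sS _ fun μ => (hd μ).1) (sS _ fun μ => (hd μ).2.1),
    key _ fun μ => (hd μ).1, key _ fun μ => (hd μ).2.1, key _ fun μ => (hd μ).2.2]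
  have source_eq : source M a χ φ ψ Nφ Nψ x ν
      = (2 * dform (ernstB M a) x ν * dot (kerrMetric M a χ) x (formM M a φ ψ x) (formE M a φ ψ x)
        - 2 * dform (ernstA M a) x ν * dot (kerrMetric M a χ) x (formM M a φ ψ x)
          (formF M a φ ψ x)) * (ernstA M a x)⁻¹
      + Nφ x * formE M a φ ψ x ν + Nψ x * formF M a φ ψ x ν := by
    rw [← div_eq_mul_inv]; rfl
  -- The product rules for divergence and curl express everything through $d\phi,d\psi,dA,dB$ and
  -- the four wave operators, which are then eliminated.
  rw [source_eq, formE_eq, formF_eq, formM_eq, divForm_add kφ kαB, divForm_sub kψ kβB,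
    divForm_sub kβB kαA, divForm_smul dα (differentiableAt_dform hB),
    divForm_smul dβ (differentiableAt_dform hB), divForm_smul dα (differentiableAt_dform hA),
    curl_add kφ kαB, curl_sub kψ kβB, curl_sub kβB kαA, curl_dform hφ, curl_dform hψ,
    curl_smul_dform dα hB, curl_smul_dform dβ hB, curl_smul_dform dα hA, eα, eβ]
  simp only [← box.eq_1]
  rw [b1, b2, b3, b4]
  simp only [zero_add, zero_sub, dot_neg_left, dot_add_right, dot_sub_left, dot_sub_right,
    dot_smul_left, dot_smul_right, Pi.add_apply, Pi.sub_apply, Pi.smul_apply, smul_eq_mul]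
  have hc := hg.dot_comm
  generalize dform φ x = p at *
  generalize dform ψ x = s at *
  generalize dform (ernstA M a) x = α at *
  generalize dform (ernstB M a) x = β at *
  -- Orienting each symmetric product one way leaves one atom per pair, so the claim is a polynomial
  -- identity.
  simp only [hc s p, hc α p, hc β p, hc α s, hc β s, hc β α]
  generalize (ernstA M a x)⁻¹ = i
  ring

end system

/-! ### Modified currents and conservation of energy -/

section system

variable {M a : ℝ} {χ : ℝ → ℝ} {x : Pt} {φ ψ Nφ Nψ : Pt → ℝ}

lemma lagr_eq (y : Pt) (E F N : Covec) (hE : formE M a φ ψ y = E) (hF : formF M a φ ψ y = F)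
    (hN : formM M a φ ψ y = N) : lagr M a χ φ ψ y = -(1 / 2) * (dot (kerrMetric M a χ) y E E
      + dot (kerrMetric M a χ) y F F + dot (kerrMetric M a χ) y N N) := by
  rw [lagr, hE, hF, hN]

/-- The current as a sum of multiples of one-forms. -/
lemma current_eq (X : Pt → Vec) (w : Pt → ℝ) (m m' : Pt → Covec) :
    current M a χ φ ψ X w m m' = fun y => (fun μ => ∑ ν, emTensor M a χ φ ψ y μ ν * X y ν)
      + ((w y * φ y) • ((1 / 2 : ℝ) • dform φ y) + ((w y * ψ y) • ((1 / 2 : ℝ) • dform ψ y)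
      + ((φ y * φ y + ψ y * ψ y) • ((-(1 / 4) : ℝ) • dform w y)
      + ((φ y * φ y) • ((1 / 4 : ℝ) • m y) + (ψ y * ψ y) • ((1 / 4 : ℝ) • m' y))))) := by
  funext y μ
  -- In $\phi E+\psi F$ the two terms with $dB$ cancel, leaving $\phi\,d\phi+\psi\,d\psi$.
  simp only [current, formE, formF, dform, Pi.add_apply, Pi.smul_apply, smul_eq_mul]
  ring

/-- The divergence of the modified currents. -/
lemma divForm_current (hM : 0 < M) (ha : |a| ≤ M) (hχ : ContDiff ℝ ∞ χ)
    (hx : x ∈ kerrRegion M a χ) {U : Set Pt} (hxU : x ∈ U) (hφ : ContDiffAt ℝ 2 φ x)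
    (hψ : ContDiffAt ℝ 2 ψ x) (hs : SolvesLinearized M a χ U φ ψ Nφ Nψ)
    {X : Pt → Vec} {w : Pt → ℝ} {m m' : Pt → Covec}
    (hX : ∀ μ, DifferentiableAt ℝ (fun y => X y μ) x) (hw : ContDiffAt ℝ 2 w x)
    (hm : ∀ μ, DifferentiableAt ℝ (fun y => m y μ) x)
    (hm' : ∀ μ, DifferentiableAt ℝ (fun y => m' y μ) x) :
    2 * divForm (kerrMetric M a χ) (current M a χ φ ψ X w m m') x
      = 2 * pairing (source M a χ φ ψ Nφ Nψ x) (X x)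
        + ∑ μ, ∑ ν, emTensor M a χ φ ψ x μ ν * deformation (kerrMetric M a χ) X x μ ν
        - 2 * w x * lagr M a χ φ ψ x
        + (φ x * dot (kerrMetric M a χ) x (m x) (dform φ x)
            + ψ x * dot (kerrMetric M a χ) x (m' x) (dform ψ x))
        + (1 / 2) * φ x ^ 2
            * (divForm (kerrMetric M a χ) m x - box (kerrMetric M a χ) w x)
        + (1 / 2) * ψ x ^ 2
            * (divForm (kerrMetric M a χ) m' x - box (kerrMetric M a χ) w x)
        + w x * (φ x * Nφ x + ψ x * Nψ x) := by
  have hg := regularAt_kerr ha hχ hx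
  have dφ := hφ.differentiableAt (by norm_num)
  have dψ := hψ.differentiableAt (by norm_num)
  have dw := hw.differentiableAt (by norm_num)
  have kφ := differentiableAt_dform hφ
  have kψ := differentiableAt_dform hψ
  have kw := differentiableAt_dform hw
  have smul_diff : ∀ (c : ℝ) (k : Pt → Covec), (∀ μ, DifferentiableAt ℝ (fun y => k y μ) x) →
      ∀ μ, DifferentiableAt ℝ (fun y => (c • k y) μ) x := fun c k hk μ => (hk μ).const_mul c
  have fsmul_diff : ∀ (f : Pt → ℝ) (k : Pt → Covec), DifferentiableAt ℝ f x →
      (∀ μ, DifferentiableAt ℝ (fun y => k y μ) x) →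
      ∀ μ, DifferentiableAt ℝ (fun y => (f y • k y) μ) x := fun f k hf hk μ => hf.fun_mul (hk μ)
  have add_diff : ∀ k l : Pt → Covec, (∀ μ, DifferentiableAt ℝ (fun y => k y μ) x) →
      (∀ μ, DifferentiableAt ℝ (fun y => l y μ) x) →
      ∀ μ, DifferentiableAt ℝ (fun y => (k y + l y) μ) x := fun k l hk hl μ => (hk μ).fun_add (hl μ)
  have hS := differentiableAt_emTensor hM ha hχ hx hφ hψ
  have hφφ := dφ.fun_mul dφ
  have hψψ := dψ.fun_mul dψ
  have t1 := fsmul_diff _ _ (dw.fun_mul dφ) (smul_diff (1 / 2) _ kφ)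
  have t2 := fsmul_diff _ _ (dw.fun_mul dψ) (smul_diff (1 / 2) _ kψ)
  have t3 := fsmul_diff _ _ (hφφ.fun_add hψψ) (smul_diff (-(1 / 4)) _ kw)
  have t4 := fsmul_diff _ _ hφφ (smul_diff (1 / 4) _ hm)
  have t5 := fsmul_diff _ _ hψψ (smul_diff (1 / 4) _ hm')
  have t45 := add_diff _ _ t4 t5
  have t345 := add_diff _ _ t3 t45
  have t2345 := add_diff _ _ t2 t345
  have hadd : dform (fun y => φ y * φ y + ψ y * ψ y) x
      = dform (fun y => φ y * φ y) x + dform (fun y => ψ y * ψ y) x :=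
    funext fun μ => pd_add μ hφφ hψψ
  obtain ⟨b1, b2, -, -⟩ := boxes_of_solves hM ha hχ hx hxU hs
  rw [current_eq, divForm_add (fun μ => DifferentiableAt.fun_sum fun ν _ => (hS μ ν).fun_mul (hX ν))
      (add_diff _ _ t1 t2345), divForm_add t1 t2345, divForm_add t2 t345, divForm_add t3 t45,
    divForm_add t4 t5, divForm_contract hS hX,
    divForm_smul (dw.fun_mul dφ) (smul_diff (1 / 2) _ kφ),
    divForm_smul (dw.fun_mul dψ) (smul_diff (1 / 2) _ kψ),
    divForm_smul (hφφ.fun_add hψψ) (smul_diff (-(1 / 4)) _ kw),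
    divForm_smul hφφ (smul_diff (1 / 4) _ hm), divForm_smul hψψ (smul_diff (1 / 4) _ hm'),
    divForm_const_smul _ kφ, divForm_const_smul _ kψ, divForm_const_smul _ kw,
    divForm_const_smul _ hm, divForm_const_smul _ hm', hadd, dform_mul dw dφ, dform_mul dw dψ,
    dform_mul dφ dφ, dform_mul dψ dψ, hg.sum_mul_deformation (emTensor_symm x), pairing]
  simp only [divTensor_emTensor hM ha hχ hx hxU hφ hψ hs, ← box.eq_1]
  -- The terms with $w$ match because the system implies
  -- $\phi\square\phi+\psi\square\psi+|d\phi|^2+|d\psi|^2=-2\mathcal L+\phi\mathcal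
  -- N_\phi+\psi\mathcal N_\psi$.
  rw [lagr_eq x _ _ _ (congrFun (formE_eq M a φ ψ) x) (congrFun (formF_eq M a φ ψ) x)
    (congrFun (formM_eq M a φ ψ) x), b1, b2]
  simp only [dot_add_left, dot_add_right, dot_sub_left, dot_sub_right,
    dot_smul_left, dot_smul_right]
  have hc := hg.dot_comm
  generalize dform φ x = p at *
  generalize dform ψ x = s at *
  generalize dform w x = d at *
  generalize m x = n at *
  generalize m' x = n' at *
  generalize dform (ernstA M a) x = α at *
  generalize dform (ernstB M a) x = β at *
  simp only [hc β p, hc β s, hc β α, hc p d, hc s d, hc p n, hc s n']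
  generalize (ernstA M a x)⁻¹ = i
  ring

/-- Without sources $J$ is a combination of $dA$ and $dB$, and $A,B$ do not depend on $t_+$. -/
lemma source_killing (hx : Nφ x = 0 ∧ Nψ x = 0) :
    pairing (source M a χ φ ψ Nφ Nψ x) vecT = 0 := by
  obtain ⟨⟨hA, -⟩, hB, -⟩ := dform_ernst_killing M a x
  simp only [dform] at hA hB
  simp [pairing, vecT, Pi.single_apply, source, hA, hB, hx.1, hx.2]

/-- The energy current is conserved. -/
lemma divForm_energyCurrent (hM : 0 < M) (ha : |a| ≤ M) (hχ : ContDiff ℝ ∞ χ)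
    (hx : x ∈ kerrRegion M a χ) {U : Set Pt} (hxU : x ∈ U) (hφ : ContDiffAt ℝ 2 φ x)
    (hψ : ContDiffAt ℝ 2 ψ x) (hs : SolvesLinearized M a χ U φ ψ Nφ Nψ)
    (hN : Nφ x = 0 ∧ Nψ x = 0) :
    divForm (kerrMetric M a χ) (energyCurrent M a χ φ ψ) x = 0 := by
  have hg := regularAt_kerr ha hχ hx
  have hdef := hg.sum_mul_deformation (emTensor_symm (M := M) (a := a) (χ := χ) (φ := φ) (ψ := ψ) x)
    fun _ => vecT
  have hkill := fun μ ν => hg.deformation_eq_zero 2 (pd_two_kerrMetric M a χ x) μ ν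
  have hsrc := source_killing (M := M) (a := a) (χ := χ) (φ := φ) (ψ := ψ) hN
  have h := divForm_contract (g := kerrMetric M a χ) (X := fun _ => vecT)
    (differentiableAt_emTensor hM ha hχ hx hφ hψ) fun ν => differentiableAt_const (vecT ν)
  simp only [divTensor_emTensor hM ha hχ hx hxU hφ hψ hs] at h
  change divForm (kerrMetric M a χ) (fun y μ => ∑ ν, emTensor M a χ φ ψ y μ ν * vecT ν) x = 0
  rw [h]
  simp only [pairing] at hsrc
  rw [hsrc, zero_add]
  have hz : ∑ μ, ∑ ν, emTensor M a χ φ ψ x μ ν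
      * deformation (kerrMetric M a χ) (fun _ => vecT) x μ ν = 0 :=
    Finset.sum_eq_zero fun μ _ => Finset.sum_eq_zero fun ν _ => by
      rw [show deformation (kerrMetric M a χ) (fun _ => vecT) x μ ν = 0 from hkill μ ν, mul_zero]
  linarith

/-! ### Axially symmetric solutions -/

lemma forms_phi_eq_zero (hφ : pd 3 φ x = 0) (hψ : pd 3 ψ x = 0) :
    formE M a φ ψ x 3 = 0 ∧ formF M a φ ψ x 3 = 0 ∧ formM M a φ ψ x 3 = 0 := by
  obtain ⟨⟨-, hA⟩, -, hB⟩ := dform_ernst_killing M a x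
  simp only [dform] at hA hB
  simp [formE, formF, formM, hA, hB, hφ, hψ]

/-- For a covector field with `Y_φ = 0`, the energy-momentum tensor vanishes on `Z` and the
vectors orthogonal to `Z`. -/
lemma formStress_vecZ {g : MetricField} {Y : Pt → Covec} (hY : Y x 3 = 0) {X : Vec}
    (hX : inner4 g x vecZ X = 0) : evalTensor (formStress g Y x) vecZ X = 0 := by
  simp only [inner4, evalTensor, formStress, vecZ, Pi.single_apply, Fin.sum_univ_four] at hX ⊢
  simp at hX ⊢
  rw [hY]
  linear_combination -(1 / 2) * dot g x (Y x) (Y x) * hX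

lemma evalTensor_add (S S' : Tensor2) (X Y : Vec) :
    evalTensor (S + S') X Y = evalTensor S X Y + evalTensor S' X Y := by
  simp only [evalTensor, ← Finset.sum_add_distrib]
  refine Finset.sum_congr rfl fun μ _ => Finset.sum_congr rfl fun ν _ => ?_
  simp only [Pi.add_apply]; ring

lemma evalTensor_emTensor (X Y : Vec) : evalTensor (emTensor M a χ φ ψ x) X Y
    = evalTensor (formStress (kerrMetric M a χ) (formE M a φ ψ) x) X Y
      + evalTensor (formStress (kerrMetric M a χ) (formF M a φ ψ) x) X Y
      + evalTensor (formStress (kerrMetric M a χ) (formM M a φ ψ) x) X Y := by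
  rw [emTensor_eq, evalTensor_add, evalTensor_add]

lemma pairing_energyCurrent (X : Vec) : pairing (energyCurrent M a χ φ ψ x) X
    = evalTensor (emTensor M a χ φ ψ x) vecT X := by
  simp only [pairing, energyCurrent, evalTensor, Finset.sum_mul]
  rw [Finset.sum_comm]
  refine Finset.sum_congr rfl fun μ _ => Finset.sum_congr rfl fun ν _ => ?_
  rw [emTensor_symm]

lemma emTensor_pos (hM : 0 < M) (ha : |a| ≤ M) (hχ : ∀ r, 0 ≤ χ r ∧ χ r ≤ 1)
    (hx : x ∈ kerrRegion M a χ) {X Y : Vec} (hX : IsFutureTimelike M a χ x X)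
    (hY : IsFutureTimelike M a χ x Y) : 0 ≤ evalTensor (emTensor M a χ φ ψ x) X Y ∧
      (formE M a φ ψ x ≠ 0 ∨ formF M a φ ψ x ≠ 0 ∨ formM M a φ ψ x ≠ 0 →
        0 < evalTensor (emTensor M a χ φ ψ x) X Y) := by
  have hf := hasFrame_kerr hM ha hχ hx
  have pos : ∀ y : Pt → Covec, y x ≠ 0 →
      0 < evalTensor (formStress (kerrMetric M a χ) y x) X Y := fun y hy =>
    hf.formStress_pos hX.1 hX.2 hY.1 hY.2 hy
  have nonneg : ∀ y : Pt → Covec, 0 ≤ evalTensor (formStress (kerrMetric M a χ) y x) X Y := by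
    intro y
    by_cases hy : y x = 0
    · simp [evalTensor, formStress, hy, dot]
    · exact (pos y hy).le
  have hE := nonneg (formE M a φ ψ)
  have hF := nonneg (formF M a φ ψ)
  have hN := nonneg (formM M a φ ψ)
  rw [evalTensor_emTensor]
  refine ⟨by positivity, ?_⟩
  rintro (h | h | h)
  · linarith [pos _ h]
  · linarith [pos _ h]
  · linarith [pos _ h]

/-! ### The normal of the time slices -/

/-- The normal is $-dt_+$ with its index raised, so lowering it returns $-dt_+$. -/
lemma metric_normal (ha : |a| ≤ M) (hx : x ∈ kerrRegion M a χ) (μ : Fin 4) :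
    ∑ ν, kerrMetric M a χ x μ ν * normalField M a χ x ν = if μ = 2 then -1 else 0 := by
  have h := congrFun (congrFun (kerrMetric_mul_kerrInv (χ := χ) ha hx) μ) 2
  have hs : ∀ ν, kerrInv M a χ x ν 2 = kerrInv M a χ x 2 ν := by
    intro ν
    fin_cases ν <;> rfl
  simp only [Matrix.mul_apply, hs] at h
  simp only [normalField, gInv_kerr ha hx, mul_neg, Finset.sum_neg_distrib, h, Matrix.one_apply]
  split_ifs <;> simp

lemma normalField_two (ha : |a| ≤ M) (hx : x ∈ kerrRegion M a χ) :
    normalField M a χ x 2 = kerrW M a χ x := by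
  simp [normalField, gInv_kerr ha hx, kerrInv]

lemma inner4_normal (ha : |a| ≤ M) (hx : x ∈ kerrRegion M a χ) (X : Vec) :
    inner4 (kerrMetric M a χ) x X (normalField M a χ x) = -X 2 := by
  have : ∀ μ, ∑ ν, kerrMetric M a χ x μ ν * X μ * normalField M a χ x ν
      = X μ * if μ = 2 then -1 else 0 := by
    intro μ
    rw [← metric_normal ha hx μ, Finset.mul_sum]
    exact Finset.sum_congr rfl fun ν _ => by ring
  simp only [inner4, evalTensor, this]
  simp

lemma isFutureTimelike_normal (hM : 0 < M) (ha : |a| ≤ M) (hχ : ∀ r, 0 ≤ χ r ∧ χ r ≤ 1)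
    (hx : x ∈ kerrRegion M a χ) : IsFutureTimelike M a χ x (normalField M a χ x) := by
  have hW := kerrW_pos hM ha hχ hx
  refine ⟨?_, ?_⟩
  · rw [inner4_normal ha hx, normalField_two ha hx]; linarith
  · rwa [normalField_two ha hx]

/-- The energy density of a covector with vanishing `φ₊` component. -/
lemma formStress_vecT_normal (ha : |a| ≤ M) (hx : x ∈ kerrRegion M a χ) {Y : Pt → Covec}
    (hY : Y x 3 = 0) :
    evalTensor (formStress (kerrMetric M a χ) Y x) vecT (normalField M a χ x)
      = (1 / 2) * (Y x 0 ^ 2 / qsq a (x 0) (x 1)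
        + Del M a (x 1) / qsq a (x 0) (x 1) * Y x 1 ^ 2 + kerrW M a χ x * Y x 2 ^ 2) := by
  have h1 : evalTensor (formStress (kerrMetric M a χ) Y x) vecT (normalField M a χ x)
      = Y x 2 * ∑ μ, Y x μ * normalField M a χ x μ
        - (1 / 2) * inner4 (kerrMetric M a χ) x vecT (normalField M a χ x)
          * dot (kerrMetric M a χ) x (Y x) (Y x) := by
    generalize normalField M a χ x = n
    simp only [inner4, evalTensor, formStress, vecT, Pi.single_apply, Fin.sum_univ_four]
    generalize dot (kerrMetric M a χ) x (Y x) (Y x) = d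
    simp
    ring
  -- Since $\mathbf g(\mathbf T,n)=-1$, the value is $Y_{t_+}Y(n)+\frac12Y_\alpha Y^\alpha$. The
  -- cross terms $Y_rY_{t_+}$ cancel and half of $W\,Y_{t_+}^2$ survives, $W$ being `kerrW`.
  rw [h1, inner4_normal ha hx]
  simp only [Fin.sum_univ_four, normalField, dot, gInv_kerr ha hx, hY]
  simp [kerrInv, vecT]
  ring

/-! ### Coercivity -/

/-- A continuous positive definite quadratic function on covectors is coercive. -/
lemma exists_coercive {Q : Covec → ℝ} (hQ : Continuous Q) (hpos : ∀ Y, Y ≠ 0 → 0 < Q Y)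
    (hsmul : ∀ (t : ℝ) Y, Q (t • Y) = t ^ 2 * Q Y) :
    ∃ c, 0 < c ∧ ∀ Y, c * ∑ μ, Y μ ^ 2 ≤ Q Y := by
  obtain ⟨Z, hZ, hmin⟩ := (isCompact_sphere (0 : Covec) 1).exists_isMinOn
    (NormedSpace.sphere_nonempty.2 zero_le_one) hQ.continuousOn
  have hZ0 : Z ≠ 0 := fun h => by simp [h] at hZ
  -- `Covec` carries the supremum norm, so the sum of four squares is at most $4\|Y\|^2$; hence a
  -- quarter of the minimum on the unit sphere.
  refine ⟨Q Z / 4, by have := hpos Z hZ0; positivity, fun Y => ?_⟩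
  by_cases hY : Y = 0
  · have h0 := hsmul 0 Y
    simp at h0
    simp [hY, h0]
  have hn : 0 < ‖Y‖ := norm_pos_iff.2 hY
  have h1 : Q Z ≤ Q (‖Y‖⁻¹ • Y) := hmin (by simp [norm_smul, hn.ne'])
  rw [hsmul] at h1
  have h2 : ∑ μ, Y μ ^ 2 ≤ 4 * ‖Y‖ ^ 2 := by
    calc ∑ μ, Y μ ^ 2 ≤ ∑ _μ : Fin 4, ‖Y‖ ^ 2 := Finset.sum_le_sum fun μ _ => by
          rw [← sq_abs]
          exact pow_le_pow_left₀ (abs_nonneg _) (norm_le_pi_norm Y μ) 2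
      _ = 4 * ‖Y‖ ^ 2 := by simp
  have h3 : Q Z * ‖Y‖ ^ 2 ≤ Q Y := by
    have := mul_le_mul_of_nonneg_right h1 (sq_nonneg ‖Y‖)
    refine this.trans_eq ?_
    field_simp
  have h4 := mul_le_mul_of_nonneg_left h2 (hpos Z hZ0).le
  linarith

/-- The vector field `T + Ω Z` that is orthogonal to `Z` is timelike outside the horizon. -/
lemma isFutureTimelike_vecT_add (hM : 0 < M) (ha : |a| ≤ M) (hx : x ∈ kerrRegion M a χ)
    (hr : rHor M a < x 1) : ∃ Ω : ℝ, IsFutureTimelike M a χ x (vecT + Ω • vecZ) := by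
  have hA : 0 < kerrMetric M a χ x 3 3 := ernstA_pos hM hx
  have hD := mul_pos (del_pos ha hr) (sin_sq_pos hx)
  have hdet := kerr_tphi_det (M := M) hx
  -- This $\Omega$ makes the vector orthogonal to $\mathbf Z$; its square is then the $(t_+,\phi_+)$
  -- determinant divided by $\mathbf g(\mathbf Z,\mathbf Z)$.
  refine ⟨-kerrMetric M a χ x 2 3 / kerrMetric M a χ x 3 3, ?_, by simp [vecT, vecZ]⟩
  have h32 := kerrMetric_symm M a χ x 3 2
  have : inner4 (kerrMetric M a χ) x
      (vecT + (-kerrMetric M a χ x 2 3 / kerrMetric M a χ x 3 3) • vecZ)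
      (vecT + (-kerrMetric M a χ x 2 3 / kerrMetric M a χ x 3 3) • vecZ)
      = -(Del M a (x 1) * Real.sin (x 0) ^ 2) / kerrMetric M a χ x 3 3 := by
    rw [← hdet]
    simp only [inner4, evalTensor, vecT, vecZ, Pi.add_apply, Pi.smul_apply, Pi.single_apply,
      Fin.sum_univ_four, h32]
    simp
    field_simp
    ring
  rw [this]
  exact div_neg_of_neg_of_pos (neg_lt_zero.2 hD) hA

/-- $\mathbf T$ itself may be spacelike in the ergoregion, so coercivity is proved for $\mathbf
T+\Omega\mathbf Z$ on all covectors. Adding $\Omega\mathbf Z$ costs nothing on covectors with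
$Y_{\phi_+}=0$ because $X\perp\mathbf Z$. The constant is chosen before $\phi,\psi$, and serves
$E,F,M$ simultaneously. -/
lemma energy_coercive (hM : 0 < M) (ha : |a| ≤ M) (hχ : ∀ r, 0 ≤ χ r ∧ χ r ≤ 1)
    (hx : x ∈ kerrRegion M a χ) (hr : rHor M a < x 1) {X : Vec}
    (hX : IsFutureTimelike M a χ x X) (hZ : inner4 (kerrMetric M a χ) x vecZ X = 0) :
    ∃ c : ℝ, 0 < c ∧ ∀ φ ψ : Pt → ℝ, pd 3 φ x = 0 → pd 3 ψ x = 0 →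
      c * ∑ μ, (formE M a φ ψ x μ ^ 2 + formF M a φ ψ x μ ^ 2 + formM M a φ ψ x μ ^ 2)
        ≤ pairing (energyCurrent M a χ φ ψ x) X := by
  obtain ⟨Ω, hΩ⟩ := isFutureTimelike_vecT_add (χ := χ) hM ha hx hr
  have hf := hasFrame_kerr hM ha hχ hx
  set g := kerrMetric M a χ
  obtain ⟨c, hc, hcoer⟩ := exists_coercive
    (Q := fun Y => evalTensor (formStress g (fun _ => Y) x) (vecT + Ω • vecZ) X)
    (by simp only [evalTensor, formStress, dot]; fun_prop)
    (fun Y hY => hf.formStress_pos hΩ.1 hΩ.2 hX.1 hX.2 hY)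
    (fun t Y => by
      simp only [evalTensor, formStress, dot_smul_left, dot_smul_right, Finset.mul_sum,
        Pi.smul_apply, smul_eq_mul]
      refine Finset.sum_congr rfl fun μ _ => Finset.sum_congr rfl fun ν _ => by ring)
  have key : ∀ Y : Pt → Covec, Y x 3 = 0 →
      c * ∑ μ, Y x μ ^ 2 ≤ evalTensor (formStress g Y x) vecT X := by
    intro Y hY
    have h1 := hcoer (Y x)
    have h2 := formStress_vecZ hY hZ
    have h3 : evalTensor (formStress g (fun _ => Y x) x) (vecT + Ω • vecZ) X
        = evalTensor (formStress g Y x) vecT X + Ω * evalTensor (formStress g Y x) vecZ X := by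
      simp only [evalTensor, Finset.mul_sum, ← Finset.sum_add_distrib]
      refine Finset.sum_congr rfl fun μ _ => Finset.sum_congr rfl fun ν _ => ?_
      simp only [formStress, Pi.add_apply, Pi.smul_apply, smul_eq_mul]
      ring
    rw [h2, mul_zero, add_zero] at h3
    exact h1.trans_eq h3
  refine ⟨c, hc, fun φ ψ hφ hψ => ?_⟩
  obtain ⟨hE, hF, hN⟩ := forms_phi_eq_zero (M := M) (a := a) hφ hψ
  rw [pairing_energyCurrent, evalTensor_emTensor]
  simp only [Finset.sum_add_distrib, mul_add]
  exact add_le_add (add_le_add (key _ hE) (key _ hF)) (key _ hN)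

end system

end KerrErnst

end

theorem mainTheorem3 (M a : ℝ) (hM : 0 < M) (ha : |a| ≤ M)
    (χ : ℝ → ℝ) (hχ : ContDiff ℝ ∞ χ) (hχ01 : ∀ r, 0 ≤ χ r ∧ χ r ≤ 1) :
    (∀ U : Set Pt, IsOpen U → U ⊆ kerrRegion M a χ →
      ∀ φ ψ Nφ Nψ : Pt → ℝ, ContDiffOn ℝ 2 φ U → ContDiffOn ℝ 2 ψ U →
      SolvesLinearized M a χ U φ ψ Nφ Nψ →
        -- positivity of the energy-momentum tensor
        (∀ x ∈ U, ∀ X Y : Vec,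
          IsFutureTimelike M a χ x X → IsFutureTimelike M a χ x Y →
            0 ≤ evalTensor (emTensor M a χ φ ψ x) X Y ∧
            (formE M a φ ψ x ≠ 0 ∨ formF M a φ ψ x ≠ 0 ∨ formM M a φ ψ x ≠ 0 →
              0 < evalTensor (emTensor M a χ φ ψ x) X Y)) ∧
        -- the divergence of the energy-momentum tensor
        (∀ x ∈ U, ∀ ν : Fin 4,
          divTensor (kerrMetric M a χ) (emTensor M a χ φ ψ) x ν
            = source M a χ φ ψ Nφ Nψ x ν) ∧
        -- the divergence of the modified currents
        (∀ (X : Pt → Vec) (w : Pt → ℝ) (m m' : Pt → Covec),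
          ContDiffOn ℝ 1 X U → ContDiffOn ℝ 2 w U → ContDiffOn ℝ 1 m U → ContDiffOn ℝ 1 m' U →
          ∀ x ∈ U,
            2 * divForm (kerrMetric M a χ) (current M a χ φ ψ X w m m') x
              = 2 * pairing (source M a χ φ ψ Nφ Nψ x) (X x)
                + ∑ μ, ∑ ν, emTensor M a χ φ ψ x μ ν * deformation (kerrMetric M a χ) X x μ ν
                - 2 * w x * lagr M a χ φ ψ x
                + (φ x * dot (kerrMetric M a χ) x (m x) (dform φ x)
                    + ψ x * dot (kerrMetric M a χ) x (m' x) (dform ψ x))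
                + (1 / 2) * φ x ^ 2
                    * (divForm (kerrMetric M a χ) m x - box (kerrMetric M a χ) w x)
                + (1 / 2) * ψ x ^ 2
                    * (divForm (kerrMetric M a χ) m' x - box (kerrMetric M a χ) w x)
                + w x * (φ x * Nφ x + ψ x * Nψ x)) ∧
        -- without source terms: `J` annihilates `T`, and the energy current is conserved
        ((∀ x ∈ U, Nφ x = 0 ∧ Nψ x = 0) → ∀ x ∈ U,
          pairing (source M a χ φ ψ Nφ Nψ x) vecT = 0 ∧
          divForm (kerrMetric M a χ) (energyCurrent M a χ φ ψ) x = 0) ∧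
        -- axial symmetry: `Q(Z, X) = 0` for `X` orthogonal to `Z`, and the energy density
        ((∀ x ∈ U, pd 3 φ x = 0 ∧ pd 3 ψ x = 0) → ∀ x ∈ U,
          (∀ X : Vec, inner4 (kerrMetric M a χ) x vecZ X = 0 →
            evalTensor (emTensor M a χ φ ψ x) vecZ X = 0) ∧
          IsFutureTimelike M a χ x (normalField M a χ x) ∧
          inner4 (kerrMetric M a χ) x vecZ (normalField M a χ x) = 0 ∧
          pairing (energyCurrent M a χ φ ψ x) (normalField M a χ x)
            = (1 / 2) *
              ((formE M a φ ψ x 0 ^ 2 + formF M a φ ψ x 0 ^ 2 + formM M a φ ψ x 0 ^ 2)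
                  / qsq a (x 0) (x 1)
                + Del M a (x 1) / qsq a (x 0) (x 1)
                  * (formE M a φ ψ x 1 ^ 2 + formF M a φ ψ x 1 ^ 2 + formM M a φ ψ x 1 ^ 2)
                + ((1 + 2 * M * x 1 / qsq a (x 0) (x 1)) * χ (x 1) ^ 2
                    + Sigsq M a (x 0) (x 1) / (qsq a (x 0) (x 1) * Del M a (x 1))
                      * (1 - χ (x 1) ^ 2))
                  * (formE M a φ ψ x 2 ^ 2 + formF M a φ ψ x 2 ^ 2 + formM M a φ ψ x 2 ^ 2)))) ∧
    -- coercivity of the energy current in the domain of outer communications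
    (∀ x ∈ kerrRegion M a χ, rHor M a < x 1 →
      ∀ X : Vec, IsFutureTimelike M a χ x X → inner4 (kerrMetric M a χ) x vecZ X = 0 →
        ∃ c : ℝ, 0 < c ∧ ∀ φ ψ : Pt → ℝ,
          DifferentiableAt ℝ φ x → DifferentiableAt ℝ ψ x → pd 3 φ x = 0 → pd 3 ψ x = 0 →
            c * ∑ μ, (formE M a φ ψ x μ ^ 2 + formF M a φ ψ x μ ^ 2 + formM M a φ ψ x μ ^ 2)
              ≤ pairing (energyCurrent M a χ φ ψ x) X) := by
  refine ⟨fun U hU hUR φ ψ Nφ Nψ hφ hψ hs => ?_, fun x hx hr X hX hZ => ?_⟩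
  · have hφx : ∀ x ∈ U, ContDiffAt ℝ 2 φ x := fun x hx => hφ.contDiffAt (hU.mem_nhds hx)
    have hψx : ∀ x ∈ U, ContDiffAt ℝ 2 ψ x := fun x hx => hψ.contDiffAt (hU.mem_nhds hx)
    refine ⟨fun x hx X Y hX hY => emTensor_pos hM ha hχ01 (hUR hx) hX hY,
      fun x hx ν => divTensor_emTensor hM ha hχ (hUR hx) hx (hφx x hx) (hψx x hx) hs ν,
      fun X w m m' hX hw hm hm' x hx => ?_,
      fun hN x hx => ⟨source_killing (hN x hx),
        divForm_energyCurrent hM ha hχ (hUR hx) hx (hφx x hx) (hψx x hx) hs (hN x hx)⟩,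
      fun hax x hx => ⟨fun X hX => ?_, isFutureTimelike_normal hM ha hχ01 (hUR hx), ?_, ?_⟩⟩
    · have hd : ∀ k : Pt → Covec, ContDiffOn ℝ 1 k U → ∀ μ, DifferentiableAt ℝ (fun y => k y μ) x :=
        fun k hk => differentiableAt_pi.1 <|
          (hk.contDiffAt (hU.mem_nhds hx)).differentiableAt (by norm_num)
      exact divForm_current hM ha hχ (hUR hx) hx (hφx x hx) (hψx x hx) hs (hd X hX)
        (hw.contDiffAt (hU.mem_nhds hx)) (hd m hm) (hd m' hm')
    · obtain ⟨hE, hF, hN⟩ := forms_phi_eq_zero (M := M) (a := a) (hax x hx).1 (hax x hx).2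
      rw [evalTensor_emTensor, formStress_vecZ hE hX, formStress_vecZ hF hX,
        formStress_vecZ hN hX]
      norm_num
    · rw [inner4_normal ha (hUR hx)]
      simp [vecZ]
    · obtain ⟨hE, hF, hN⟩ := forms_phi_eq_zero (M := M) (a := a) (hax x hx).1 (hax x hx).2
      rw [pairing_energyCurrent, evalTensor_emTensor, formStress_vecT_normal ha (hUR hx) hE,
        formStress_vecT_normal ha (hUR hx) hF, formStress_vecT_normal ha (hUR hx) hN]
      -- Only factors and inverses are rearranged, so this also holds where $\Delta=0$: both
      -- quotients are then $0$ by the convention for division by zero.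
      have hW : Sigsq M a (x 0) (x 1) / (qsq a (x 0) (x 1) * Del M a (x 1)) * (1 - χ (x 1) ^ 2)
          = Sigsq M a (x 0) (x 1) * kerrU M a χ (x 1) / qsq a (x 0) (x 1) := by
        simp only [kerrU, div_eq_mul_inv, mul_inv]; ring
      rw [hW, kerrW]
      ring
  · obtain ⟨c, hc, h⟩ := energy_coercive hM ha hχ01 hx hr hX hZ
    exact ⟨c, hc, fun φ ψ _ _ => h φ ψ⟩
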